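/- **Theorem 3.4 (Abstract Density Theorem).** *Setting.* Let $H$ be a separable Hilbert space, $I$ a countable set, and $G=\prod_{i=1}^d \alpha_i\mathbf Z\times\prod_{l=1}^e \mathbf Z_{n_l}$ with $d\ge 1$, $e\ge 0$, $\alpha_i>0$, $n_l\ge 1$, equipped with $|g|=\sup\{|\alpha_1k_1|,\dots,|\alpha_dk_d|,\delta(m_1),\dots,\delta(m_e)\}$ for $g=(\alpha_1k_1,\dots,\alpha_dk_d,m_1,\dots,m_e)$, where $\delta(0)=0$ and $\delta(m)=1$ for $m\ne 0$. Let $a\colon I\to G$ be a map, and for $N\in\mathbf N$, $j\in G$ put $S_N(j)=\{k\in G:|k-j|\le N/2\}$ and $I_N(j)=a^{-1}(S_N(j))$. Define $$D^-(I,a)=\liminf_{N\to\infty}\inf_{j\in G}\frac{|I_N(j)|}{|S_N(j)|},\qquad D^+(I,a)=\limsup_{N\to\infty}\sup_{j\in G}\frac{|I_N(j)|}{|S_N(j)|},$$ and, for a free ultrafilter $p$ on $\mathbf N$ and a sequence of centers $c=(c_N)_{N\in\mathbf N}$ in $G$, $$D(p,c)=\operatorname*{p\text{-}lim}_{N}\frac{|I_N(c_N)|}{|S_N(c_N)|}.$$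 A family $\mathcal F=\{f_i\}_{i\in I}$ in $H$ is a frame for $H$ if there are $A,B>0$ with $A\|f\|^2\le\sum_{i}|\langle f,f_i\rangle|^2\le B\|f\|^2$ for all $f\in H$; its canonical dual frame is $\tilde f_i=S^{-1}f_i$, where $Sf=\sum_i\langle f,f_i\rangle f_i$ (then $0\le\langle f_i,\tilde f_i\rangle\le 1$). A family is a Riesz basis for $H$ if it is the image of an orthonormal basis of $H$ under a continuous invertible linear map. The measures of a frame $\mathcal F=\{f_i\}_{i\in I}$ are $$\mathcal M(\mathcal F;p,c)=\operatorname*{p\text{-}lim}_{N}\frac1{|I_N(c_N)|}\sum_{i\in I_N(c_N)}\langle f_i,\tilde f_i\rangle,$$ $$\mathcal M^-(\mathcal F)=\liminf_{N\to\infty}\inf_{j\in G}\frac1{|I_N(j)|}\sum_{i\in I_N(j)}\langle f_i,\tilde f_i\rangle,\qquad \mathcal M^+(\mathcal F)=\limsup_{N\to\infty}\sup_{j\in G}\frac1{|I_N(j)|}\sum_{i\in I_N(j)}\langle f_i,\tilde f_i\rangle,$$ where an average over an empty set is read as $0$. For a frame $\mathcal E=\{e_j\}_{j\in G}$ the measures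 are defined in the same way with $S_N$ in place of $I_N$. *Statement.* Let $\mathcal F=\{f_i\}_{i\in I}$ and $\mathcal E=\{e_j\}_{j\in G}$ be frames for $H$ and suppose $D^+(I,a)<\infty$. Suppose that $(\mathcal F,a,\mathcal E)$ has $\ell^2$-column decay and $\ell^2$-row decay, i.e. for every $\varepsilon>0$ there is an integer $N_\varepsilon>0$ with $\sum_{i\in I\setminus I_{N_\varepsilon}(j)}|\langle f_i,e_j\rangle|^2<\varepsilon$ for all $j\in G$, and for every $\varepsilon>0$ there is an integer $N_\varepsilon>0$ with $\sum_{j\in G\setminus S_{N_\varepsilon}(a(i))}|\langle f_i,e_j\rangle|^2<\varepsilon$ for all $i\in I$. Then: (a) For each free ultrafilter $p$ and each sequence of centers $c$ in $G$, $$\mathcal M(\mathcal E;p,c)=D(p,c)\cdot\mathcal M(\mathcal F;p,c).$$ Moreover, $$\mathcal M^-(\mathcal E)\le D^+(I,a)\cdot\mathcal M^-(\mathcal F)\le\mathcal M^+(\mathcal E),\qquad \mathcal M^-(\mathcal E)\le D^-(I,a)\cdot\mathcal M^+(\mathcal F)\le\mathcal M^+(\mathcal E).$$ (b) If $D^+(I,a)>\mathcal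 M^+(\mathcal E)$, then there is an infinite set $J\subset I$ such that $\{f_i\}_{i\in I\setminus J}$ is still a frame for $H$. If $\mathcal E$ is a Riesz basis for $H$, then in addition: (c) For each free ultrafilter $p$ and each sequence of centers $c$ in $G$, $$\mathcal M(\mathcal F;p,c)=\frac1{D(p,c)},\qquad \mathcal M^-(\mathcal F)=\frac1{D^+(I,a)},\qquad \mathcal M^+(\mathcal F)=\frac1{D^-(I,a)}.$$ (d) $D^-(I,a)\ge 1$. (e) If $D^+(I,a)>1$, then there is an infinite set $J\subset I$ such that $\{f_i\}_{i\in I\setminus J}$ is still a frame for $H$. (f) If $\mathcal F$ is also a Riesz basis for $H$, then for each free ultrafilter $p$ and each sequence of centers $c$ in $G$, $$D^-(I,a)=D(p,c)=D^+(I,a)=1,\qquad \mathcal M^-(\mathcal F)=\mathcal M(\mathcal F;p,c)=\mathcal M^+(\mathcal F)=1.$$ -/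

import Mathlib

open scoped ENNReal

noncomputable section

namespace FrameDensity

/-! ### The reference group and its boxes -/

/-- The group `G = ∏_{i=1}^d α_i ℤ × ∏_{l=1}^e ℤ_{n_l}`. An element
`(α_1 k_1, …, α_d k_d, m_1, …, m_e)` is recorded by `(k_1, …, k_d)` and `(m_1, …, m_e)`; the
spacings `α_i` enter through the size function below. -/
abbrev RefGroup (d : ℕ) {e : ℕ} (n : Fin e → ℕ) : Type :=
  (Fin d → ℤ) × ((l : Fin e) → ZMod (n l))

/-- `|g| = sup {|α_1 k_1|, …, |α_d k_d|, δ(m_1), …, δ(m_e)}` with `δ(0) = 0` and `δ(m) = 1` for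
`m ≠ 0`. (An empty real supremum is `0` in Mathlib.) -/
def size {d e : ℕ} {n : Fin e → ℕ} (α : Fin d → ℝ) (g : RefGroup d n) : ℝ :=
  max (⨆ i, |α i * (g.1 i : ℝ)|) (⨆ l, if g.2 l = 0 then (0 : ℝ) else 1)

/-- The box `S_N(j) = {k ∈ G : |k - j| ≤ N / 2}`. -/
def box {d e : ℕ} {n : Fin e → ℕ} (α : Fin d → ℝ) (N : ℕ) (j : RefGroup d n) :
    Set (RefGroup d n) :=
  {k | size α (k - j) ≤ (N : ℝ) / 2}

/-- `I_N(j) = a⁻¹(S_N(j))`. -/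
def preBox {d e : ℕ} {n : Fin e → ℕ} {I : Type*} (α : Fin d → ℝ) (a : I → RefGroup d n)
    (N : ℕ) (j : RefGroup d n) : Set I :=
  a ⁻¹' box α N j

/-! ### Densities -/

/-- `|I_N(j)| / |S_N(j)|`, equal to `∞` when `I_N(j)` is infinite. -/
def boxDensity {d e : ℕ} {n : Fin e → ℕ} {I : Type*} (α : Fin d → ℝ) (a : I → RefGroup d n)
    (N : ℕ) (j : RefGroup d n) : ℝ≥0∞ :=
  ((preBox α a N j).encard : ℝ≥0∞) / ((box α N j).encard : ℝ≥0∞)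

/-- The lower density `D⁻(I, a)`. -/
def lowerDensity {d e : ℕ} {n : Fin e → ℕ} {I : Type*} (α : Fin d → ℝ)
    (a : I → RefGroup d n) : ℝ≥0∞ :=
  Filter.liminf (fun N : ℕ => ⨅ j, boxDensity α a N j) Filter.atTop

/-- The upper density `D⁺(I, a)`. -/
def upperDensity {d e : ℕ} {n : Fin e → ℕ} {I : Type*} (α : Fin d → ℝ)
    (a : I → RefGroup d n) : ℝ≥0∞ :=
  Filter.limsup (fun N : ℕ => ⨆ j, boxDensity α a N j) Filter.atTop

/-- An ultrafilter on `ℕ` is free if it contains every cofinite set. -/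
def IsFree (p : Ultrafilter ℕ) : Prop :=
  (p : Filter ℕ) ≤ Filter.cofinite

/-- The limit along the ultrafilter `p` of a sequence in `[0, ∞]`. It always exists and is unique,
`[0, ∞]` being compact and Hausdorff. -/
def pLim (p : Ultrafilter ℕ) (u : ℕ → ℝ≥0∞) : ℝ≥0∞ :=
  (p : Filter ℕ).limUnder u

/-- `pLim` is the limit along `p`. -/
theorem tendsto_pLim (p : Ultrafilter ℕ) (u : ℕ → ℝ≥0∞) :
    Filter.Tendsto u (p : Filter ℕ) (nhds (pLim p u)) := by
  obtain ⟨x, -, hx⟩ := isCompact_univ.ultrafilter_le_nhds (p.map u) (by simp)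
  exact tendsto_nhds_limUnder ⟨x, hx⟩

/-- The density `D(p, c) = D(p, c; I, a)`. -/
def density {d e : ℕ} {n : Fin e → ℕ} {I : Type*} (α : Fin d → ℝ) (a : I → RefGroup d n)
    (p : Ultrafilter ℕ) (c : ℕ → RefGroup d n) : ℝ≥0∞ :=
  pLim p (fun N => boxDensity α a N (c N))

/-! ### Frames, Riesz bases and canonical duals -/

section Frames

variable (𝕜 : Type*) [RCLike 𝕜] {H : Type*} [NormedAddCommGroup H] [InnerProductSpace 𝕜 H]

/-- `f` is a frame for `H`: there are `A, B > 0` with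
`A ‖x‖² ≤ ∑_i |⟨x, f_i⟩|² ≤ B ‖x‖²` for all `x`. -/
def IsFrame {ι : Type*} (f : ι → H) : Prop :=
  ∃ A B : ℝ, 0 < A ∧ 0 < B ∧ ∀ x : H,
    ENNReal.ofReal (A * ‖x‖ ^ 2) ≤ ∑' i, ‖inner 𝕜 (f i) x‖ₑ ^ 2 ∧
    ∑' i, ‖inner 𝕜 (f i) x‖ₑ ^ 2 ≤ ENNReal.ofReal (B * ‖x‖ ^ 2)

/-- `f` is a Riesz basis for `H`: the image of an orthonormal basis of `H` under a continuous
invertible linear map. -/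
def IsRieszBasis {ι : Type*} (f : ι → H) : Prop :=
  ∃ (b : HilbertBasis ι 𝕜 H) (T : H ≃L[𝕜] H), ∀ i, f i = T (b i)

/-- The frame operator `S x = ∑_i ⟨x, f_i⟩ f_i`. For a frame the series converges
unconditionally and `S` is a bijection of `H`. -/
def frameOp {ι : Type*} (f : ι → H) (x : H) : H :=
  ∑' i, inner 𝕜 (f i) x • f i

/-- The canonical dual frame `f̃_i = S⁻¹ f_i`. -/
def canonicalDual {ι : Type*} (f : ι → H) (i : ι) : H :=
  Function.invFun (frameOp 𝕜 f) (f i)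

/-- The number `⟨f_i, f̃_i⟩`. For a frame it equals `⟨f_i, S⁻¹ f_i⟩`, which is real and lies in
`[0, 1]`, so that nothing is lost by recording its real part in `[0, ∞]`. -/
def dualPairing {ι : Type*} (f : ι → H) (i : ι) : ℝ≥0∞ :=
  ENNReal.ofReal (RCLike.re (inner 𝕜 (canonicalDual 𝕜 f i) (f i)))

/-! ### Localization -/

variable {d e : ℕ} {n : Fin e → ℕ} {I : Type*}

/-- `(F, a, E)` has `ℓ²`-column decay. -/
def ColumnDecay (α : Fin d → ℝ) (a : I → RefGroup d n) (f : I → H)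
    (g : RefGroup d n → H) : Prop :=
  ∀ ε : ℝ, 0 < ε → ∃ N : ℕ, 0 < N ∧ ∀ j : RefGroup d n,
    ∑' i : ↥(preBox α a N j)ᶜ, ‖inner 𝕜 (g j) (f i)‖ₑ ^ 2 < ENNReal.ofReal ε

/-- `(F, a, E)` has `ℓ²`-row decay. -/
def RowDecay (α : Fin d → ℝ) (a : I → RefGroup d n) (f : I → H)
    (g : RefGroup d n → H) : Prop :=
  ∀ ε : ℝ, 0 < ε → ∃ N : ℕ, 0 < N ∧ ∀ i : I,
    ∑' j : ↥(box α N (a i))ᶜ, ‖inner 𝕜 (g j) (f i)‖ₑ ^ 2 < ENNReal.ofReal ε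

/-! ### Measures of a frame

The measures of a frame `E` indexed by the reference group itself are those for `a = id`, for
which `I_N(j) = S_N(j)`. -/

/-- The average `|I_N(j)|⁻¹ ∑_{i ∈ I_N(j)} ⟨f_i, f̃_i⟩`; it is `0` if `I_N(j)` is empty. -/
def boxAverage (α : Fin d → ℝ) (a : I → RefGroup d n) (f : I → H) (N : ℕ)
    (j : RefGroup d n) : ℝ≥0∞ :=
  (∑' i : ↥(preBox α a N j), dualPairing 𝕜 f i) / ((preBox α a N j).encard : ℝ≥0∞)

/-- The measure `M(F; p, c)`. -/
def frameMeasure (α : Fin d → ℝ) (a : I → RefGroup d n) (f : I → H)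
    (p : Ultrafilter ℕ) (c : ℕ → RefGroup d n) : ℝ≥0∞ :=
  pLim p (fun N => boxAverage 𝕜 α a f N (c N))

/-- The lower measure `M⁻(F)`. -/
def lowerMeasure (α : Fin d → ℝ) (a : I → RefGroup d n) (f : I → H) : ℝ≥0∞ :=
  Filter.liminf (fun N : ℕ => ⨅ j, boxAverage 𝕜 α a f N j) Filter.atTop

/-- The upper measure `M⁺(F)`. -/
def upperMeasure (α : Fin d → ℝ) (a : I → RefGroup d n) (f : I → H) : ℝ≥0∞ :=
  Filter.limsup (fun N : ℕ => ⨆ j, boxAverage 𝕜 α a f N j) Filter.atTop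

end Frames

end FrameDensity

end

open FrameDensity

/-! The numbers ⟨f_i, f̃_i⟩ and ⟨e_k, ẽ_k⟩ are the row and column sums of a single matrix, t i k =
Re(⟨f̃_i, ẽ_k⟩⟨e_k, f_i⟩): expand f_i in the frame `E`, or e_k in the frame `F`. Bessel bounds for
the duals turn the ℓ² decay of ⟨e_k, f_i⟩ into uniform ℓ¹ decay of t away from k = a(i). Over a
large box the totals of the row sums and of the column sums both agree with the sum of the block
I_N(j) × S_N(j), up to small tails and the rows and columns near the boundary. The latter are
o(|S_N|) in number, because |S_N| grows like N^d and `a` has bounded fibres. Dividing by |S_N|, the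
average of `E` is the density times the average of `F` up to o(1), uniformly in the centre
(`eventually_boxAverage_near`).

Limits along p give the identity in (a). Each liminf of infima and limsup of suprema is itself a
limit along some free ultrafilter and centres (`exists_isFree_tendsto_limsup_iSup`), which gives the
inequalities. For a Riesz basis all pairings are 1, and (c), (d), (f) are then arithmetic.

For (b) and (e), centres realising D⁺ have M(F; p, c) < 1, so infinitely many pairings are at most
some L < 1. The Gram matrix (⟨f_i, f̃_k⟩) has square-summable rows and the pairings on its diagonal.
A sparse infinite subset J is thus almost orthogonal in the sense of `sum_norm_inner_sq_le_of_gram`,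
and carries only a fraction L + ε < 1 of Σ|⟨x, f_i⟩|² (`IsFrame.exists_infinite_removable`). -/

namespace FrameDensity

open Filter Topology

/-! ### Analysis operator, frame operator and canonical dual. -/

section Frames

variable {𝕜 : Type*} [RCLike 𝕜] {H : Type*} [NormedAddCommGroup H] [InnerProductSpace 𝕜 H]

theorem summable_norm_sq_of_tsum_enorm_le {ι : Type*} {u : ι → 𝕜} {b : ℝ}
    (h : ∑' i, ‖u i‖ₑ ^ 2 ≤ ENNReal.ofReal b) : Summable fun i => ‖u i‖ ^ 2 := by
  have h1 : ∑' i, ‖u i‖ₑ ^ 2 ≠ ∞ := ne_top_of_le_ne_top ENNReal.ofReal_ne_top h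
  refine (ENNReal.summable_toReal h1).congr fun i => ?_
  simp

theorem tsum_enorm_sq_eq_ofReal {ι : Type*} {u : ι → 𝕜} (h : Summable fun i => ‖u i‖ ^ 2) :
    ∑' i, ‖u i‖ₑ ^ 2 = ENNReal.ofReal (∑' i, ‖u i‖ ^ 2) := by
  rw [ENNReal.ofReal_tsum_of_nonneg (fun i => sq_nonneg _) h]
  refine tsum_congr fun i => ?_
  rw [ENNReal.ofReal_pow (norm_nonneg _), ofReal_norm]

/-- The square-summable coefficient sequence has the expected norm in `ℓ²`. -/
theorem lp_norm_sq {ι : Type*} (c : lp (fun _ : ι => 𝕜) 2) :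
    ‖c‖ ^ 2 = ∑' i, ‖c i‖ ^ 2 := by
  have := lp.norm_rpow_eq_tsum (p := 2) (by norm_num) c
  simpa using this

theorem lp_summable_norm_sq {ι : Type*} (c : lp (fun _ : ι => 𝕜) 2) :
    Summable fun i => ‖c i‖ ^ 2 := by
  have := (lp.memℓp c).summable (by norm_num)
  simpa using this

/-- The analysis operator of a frame. -/
theorem IsFrame.exists_analysis {ι : Type*} {f : ι → H} (hf : IsFrame 𝕜 f) :
    ∃ C : H →L[𝕜] lp (fun _ : ι => 𝕜) 2, ∀ x i, C x i = inner 𝕜 (f i) x := by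
  obtain ⟨A, B, hA, hB, h⟩ := hf
  have hs : ∀ x : H, Summable fun i => ‖inner 𝕜 (f i) x‖ ^ 2 := fun x =>
    summable_norm_sq_of_tsum_enorm_le (h x).2
  have hmem : ∀ x : H, Memℓp (fun i => inner 𝕜 (f i) x) 2 := fun x =>
    memℓp_gen (by simpa using hs x)
  let L : H →ₗ[𝕜] lp (fun _ : ι => 𝕜) 2 :=
    { toFun := fun x => ⟨fun i => inner 𝕜 (f i) x, hmem x⟩
      map_add' := fun x y => by ext i; exact inner_add_right _ _ _
      map_smul' := fun c x => by ext i; exact inner_smul_right _ _ _ }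
  refine ⟨L.mkContinuous (Real.sqrt B) fun x => ?_, fun x i => rfl⟩
  refine le_of_sq_le_sq ?_ (by positivity)
  rw [lp_norm_sq, mul_pow, Real.sq_sqrt hB.le]
  have h2 := (h x).2
  rw [tsum_enorm_sq_eq_ofReal (hs x), ENNReal.ofReal_le_ofReal_iff (by positivity)] at h2
  exact h2

/-- Test the bound at x = f i and keep only the i-th term: ‖f i‖⁴ ≤ B‖f i‖². -/
theorem norm_le_of_bessel {ι : Type*} {f : ι → H} {B : ℝ} (hB : 0 < B)
    (h : ∀ x : H, ∑' i, ‖inner 𝕜 (f i) x‖ₑ ^ 2 ≤ ENNReal.ofReal (B * ‖x‖ ^ 2)) (i : ι) :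
    ‖f i‖ ^ 2 ≤ B := by
  have h1 := (ENNReal.le_tsum i).trans (h (f i))
  rw [← ofReal_norm, ← ENNReal.ofReal_pow (norm_nonneg _),
    ENNReal.ofReal_le_ofReal_iff (by positivity)] at h1
  rw [inner_self_eq_norm_sq_to_K, norm_pow, RCLike.norm_ofReal, abs_norm] at h1
  rcases eq_or_lt_of_le (sq_nonneg ‖f i‖) with h0 | h0
  · rw [← h0]; exact hB.le
  · exact le_of_mul_le_mul_right (by nlinarith) h0

variable [CompleteSpace H]

theorem IsFrame.hasSum_adjoint_analysis {ι : Type*} {f : ι → H}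
    {C : H →L[𝕜] lp (fun _ : ι => 𝕜) 2} (hC : ∀ x i, C x i = inner 𝕜 (f i) x)
    (c : lp (fun _ : ι => 𝕜) 2) :
    HasSum (fun i => c i • f i) (ContinuousLinearMap.adjoint C c) := by
  classical
  have h1 := (lp.hasSum_single (p := 2) (by norm_num) c).mapL (ContinuousLinearMap.adjoint C)
  convert h1 using 2 with i
  refine ext_inner_right 𝕜 fun x => ?_
  rw [ContinuousLinearMap.adjoint_inner_left, lp.inner_single_left, hC, inner_smul_left]
  simp [RCLike.inner_apply, mul_comm]

/-- The frame operator of a frame is an isomorphism, and it factors through the analysis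
operator. -/
theorem IsFrame.exists_frameOp_equiv {ι : Type*} {f : ι → H} (hf : IsFrame 𝕜 f) :
    ∃ (C : H →L[𝕜] lp (fun _ : ι => 𝕜) 2) (S : H ≃L[𝕜] H),
      (∀ x i, C x i = inner 𝕜 (f i) x) ∧ (∀ x, frameOp 𝕜 f x = S x) ∧
      (∀ x y, inner 𝕜 (S x) y = inner 𝕜 (C x) (C y)) ∧
      ∀ i, canonicalDual 𝕜 f i = S.symm (f i) := by
  obtain ⟨C, hC⟩ := hf.exists_analysis
  obtain ⟨A, B, hA, hB, h⟩ := hf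
  set T : H →L[𝕜] H := ContinuousLinearMap.adjoint C ∘L C with hT
  have hin : ∀ x y, inner 𝕜 (T x) y = inner 𝕜 (C x) (C y) := fun x y => by
    simp [hT, ContinuousLinearMap.adjoint_inner_left]
  -- The lower frame bound is the coercivity of C*C.
  have hunit : IsUnit T := by
    refine ContinuousLinearMap.isUnit_of_forall_le_norm_inner_map T (c := ⟨A, hA.le⟩) hA fun x => ?_
    rw [hin, inner_self_eq_norm_sq_to_K, norm_pow, RCLike.norm_ofReal, abs_norm]
    have h1 := (h x).1
    have hs : Summable fun i => ‖inner 𝕜 (f i) x‖ ^ 2 :=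
      summable_norm_sq_of_tsum_enorm_le (h x).2
    rw [tsum_enorm_sq_eq_ofReal hs,
      ENNReal.ofReal_le_ofReal_iff (tsum_nonneg fun i => sq_nonneg _)] at h1
    have h2 := lp_norm_sq (C x)
    simp only [hC] at h2
    rw [h2, mul_comm]
    exact h1
  obtain ⟨u, hu⟩ := hunit
  have hop : ∀ x, frameOp 𝕜 f x = ContinuousLinearEquiv.ofUnit u x := fun x => by
    have h1 : ContinuousLinearEquiv.ofUnit u x = T x := by rw [← hu]; rfl
    rw [h1]
    have := (IsFrame.hasSum_adjoint_analysis hC (C x)).tsum_eq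
    simp only [hC] at this
    exact this
  refine ⟨C, ContinuousLinearEquiv.ofUnit u, hC, hop, fun x y => ?_, fun i => ?_⟩
  · rw [← hin, ← hu]; rfl
  -- Bijectivity is what makes `Function.invFun` in `canonicalDual` a genuine inverse.
  · have hbij : Function.Bijective (frameOp 𝕜 f) := by
      rw [show frameOp 𝕜 f = ContinuousLinearEquiv.ofUnit u from funext hop]
      exact (ContinuousLinearEquiv.ofUnit u).bijective
    apply hbij.1
    rw [canonicalDual, Function.invFun_eq (hbij.2 (f i)), hop]
    simp

/-- Self-adjointness of S⁻¹, obtained by moving S across the inner product through C. -/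
theorem IsFrame.inner_canonicalDual_comm {ι : Type*} {f : ι → H} (hf : IsFrame 𝕜 f) (i k : ι) :
    inner 𝕜 (canonicalDual 𝕜 f i) (f k) = inner 𝕜 (f i) (canonicalDual 𝕜 f k) := by
  obtain ⟨C, S, hC, hop, hS, hd⟩ := hf.exists_frameOp_equiv
  rw [hd, hd]
  conv_lhs => rw [← S.apply_symm_apply (f k), ← inner_conj_symm, hS, inner_conj_symm]
  conv_rhs => rw [← S.apply_symm_apply (f i), hS]

/-- The reconstruction formula, paired with a vector. -/
theorem IsFrame.hasSum_inner {ι : Type*} {f : ι → H} (hf : IsFrame 𝕜 f) (x y : H) :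
    HasSum (fun k => inner 𝕜 x (canonicalDual 𝕜 f k) * inner 𝕜 (f k) y) (inner 𝕜 x y) := by
  obtain ⟨C, S, hC, hop, hS, hd⟩ := hf.exists_frameOp_equiv
  have h1 := lp.hasSum_inner (𝕜 := 𝕜) (G := fun _ : ι => 𝕜) (C (S.symm x)) (C y)
  rw [← hS, S.apply_symm_apply] at h1
  convert h1 using 2 with k
  rw [hC, hC, hd, RCLike.inner_apply, mul_comm, inner_conj_symm]
  congr 1
  conv_lhs => rw [← S.apply_symm_apply x, hS]
  conv_rhs => rw [← S.apply_symm_apply (f k), ← inner_conj_symm, hS, inner_conj_symm]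

/-- The canonical dual of a frame is a Bessel sequence. -/
theorem IsFrame.exists_bessel_dual {ι : Type*} {f : ι → H} (hf : IsFrame 𝕜 f) :
    ∃ B : ℝ, 0 < B ∧ ∀ x : H,
      ∑' i, ‖inner 𝕜 (canonicalDual 𝕜 f i) x‖ₑ ^ 2 ≤ ENNReal.ofReal (B * ‖x‖ ^ 2) := by
  obtain ⟨C, S, hC, hop, hS, hd⟩ := hf.exists_frameOp_equiv
  obtain ⟨A, B, hA, hB, h⟩ := hf
  -- The dual coefficients of x are the frame coefficients of S⁻¹x. The `+ 1` keeps the constant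
  -- positive even when H is trivial.
  refine ⟨B * (‖(S.symm : H →L[𝕜] H)‖ ^ 2 + 1), by positivity, fun x => ?_⟩
  have h1 := (h (S.symm x)).2
  have h2 : ∀ i, inner 𝕜 (canonicalDual 𝕜 f i) x = inner 𝕜 (f i) (S.symm x) := fun i => by
    rw [hd]
    conv_lhs => rw [← S.apply_symm_apply x, ← inner_conj_symm, hS, inner_conj_symm]
    conv_rhs => rw [← S.apply_symm_apply (f i), hS]
  simp only [h2]
  refine h1.trans (ENNReal.ofReal_le_ofReal ?_)
  rw [mul_assoc]
  refine mul_le_mul_of_nonneg_left ?_ hB.le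
  have h3 : ‖S.symm x‖ ≤ ‖(S.symm : H →L[𝕜] H)‖ * ‖x‖ := (S.symm : H →L[𝕜] H).le_opNorm x
  have h4 := pow_le_pow_left₀ (norm_nonneg _) h3 2
  nlinarith [sq_nonneg ‖x‖]

end Frames

/-! ### The numbers ⟨f_i, f̃_i⟩ and removal of elements. -/

section Pairing

variable (𝕜 : Type*) [RCLike 𝕜] {H : Type*} [NormedAddCommGroup H] [InnerProductSpace 𝕜 H]

/-- The real number `⟨f_i, f̃_i⟩`. -/
noncomputable def realPairing {ι : Type*} (f : ι → H) (i : ι) : ℝ :=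
  RCLike.re (inner 𝕜 (canonicalDual 𝕜 f i) (f i))

variable {𝕜}

theorem dualPairing_eq_ofReal {ι : Type*} (f : ι → H) (i : ι) :
    dualPairing 𝕜 f i = ENNReal.ofReal (realPairing 𝕜 f i) := rfl

/-- A Bessel bound for vectors whose Gram matrix is close to a diagonal one. -/
theorem sum_norm_inner_sq_le_of_gram {V : Type*} [NormedAddCommGroup V] [InnerProductSpace 𝕜 V]
    {ι : Type*} (s : Finset ι) (φ : ι → V) (w : ι → ℝ) {L ε : ℝ} (hL : 0 ≤ L) (hε : 0 ≤ ε)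
    (hdiag : ∀ i ∈ s, ‖φ i‖ ^ 2 ≤ L)
    (hoff : ∀ i ∈ s, ∀ k ∈ s, i ≠ k → ‖inner 𝕜 (φ i) (φ k)‖ ≤ ε * (w i * w k))
    (hw0 : ∀ i ∈ s, 0 ≤ w i) (hw : ∑ i ∈ s, w i ^ 2 ≤ 1) (y : V) :
    ∑ i ∈ s, ‖inner 𝕜 (φ i) y‖ ^ 2 ≤ (L + ε) * ‖y‖ ^ 2 := by
  classical
  set c : ι → 𝕜 := fun i => inner 𝕜 (φ i) y with hc
  set Q : ℝ := ∑ i ∈ s, ‖c i‖ ^ 2 with hQ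
  have hQ0 : 0 ≤ Q := Finset.sum_nonneg fun i _ => sq_nonneg _
  -- Duality: ⟨v, y⟩ = Q, while the Gram bounds give ‖v‖² ≤ (L + ε)Q, so Cauchy–Schwarz yields Q² ≤
  -- (L + ε)Q‖y‖².
  set v : V := ∑ i ∈ s, c i • φ i with hv
  have hvy : inner 𝕜 v y = (Q : 𝕜) := by
    rw [hv, sum_inner, hQ, RCLike.ofReal_sum]
    refine Finset.sum_congr rfl fun i _ => ?_
    rw [inner_smul_left, RCLike.conj_mul, RCLike.ofReal_pow]
  have hvn : ‖v‖ ^ 2 ≤ (L + ε) * Q := by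
    have h1 : ‖v‖ ^ 2 ≤ ∑ i ∈ s, ∑ k ∈ s, ‖c i‖ * ‖c k‖ * ‖inner 𝕜 (φ i) (φ k)‖ := by
      calc ‖v‖ ^ 2 = ‖inner 𝕜 v v‖ := by
            rw [inner_self_eq_norm_sq_to_K, norm_pow, RCLike.norm_ofReal, abs_norm]
        _ = ‖∑ i ∈ s, ∑ k ∈ s, inner 𝕜 (c i • φ i) (c k • φ k)‖ := by
            rw [hv, sum_inner]
            simp_rw [inner_sum]
        _ ≤ _ := by
            refine (norm_sum_le _ _).trans (Finset.sum_le_sum fun i _ => ?_)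
            refine (norm_sum_le _ _).trans (Finset.sum_le_sum fun k _ => le_of_eq ?_)
            rw [inner_smul_left, inner_smul_right, norm_mul, norm_mul, RCLike.norm_conj]
            ring
    -- The nonnegative ε-term is added on the diagonal too, so that its double sum factors as a
    -- square.
    have h2 : ∀ i ∈ s, ∀ k ∈ s, ‖c i‖ * ‖c k‖ * ‖inner 𝕜 (φ i) (φ k)‖ ≤
        (if i = k then L * ‖c i‖ ^ 2 else 0) + ε * ((‖c i‖ * w i) * (‖c k‖ * w k)) := by
      intro i hi k hk
      have hwi := hw0 i hi
      have hwk := hw0 k hk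
      split_ifs with hik
      · subst hik
        rw [inner_self_eq_norm_sq_to_K, norm_pow, RCLike.norm_ofReal, abs_norm]
        have h3 : 0 ≤ ε * ((‖c i‖ * w i) * (‖c i‖ * w i)) := by positivity
        have h4 := mul_le_mul_of_nonneg_left (hdiag i hi) (sq_nonneg ‖c i‖)
        nlinarith
      · have h4 := mul_le_mul_of_nonneg_left (hoff i hi k hk hik)
          (mul_nonneg (norm_nonneg (c i)) (norm_nonneg (c k)))
        rw [zero_add]
        refine h4.trans (le_of_eq ?_)
        ring
    have h3 : ∑ i ∈ s, ∑ k ∈ s, ‖c i‖ * ‖c k‖ * ‖inner 𝕜 (φ i) (φ k)‖ ≤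
        L * Q + ε * (∑ i ∈ s, ‖c i‖ * w i) ^ 2 := by
      refine (Finset.sum_le_sum fun i hi => Finset.sum_le_sum fun k hk => h2 i hi k hk).trans ?_
      simp_rw [Finset.sum_add_distrib]
      refine add_le_add (le_of_eq ?_) (le_of_eq ?_)
      · rw [hQ, Finset.mul_sum]
        refine Finset.sum_congr rfl fun i hi => ?_
        rw [Finset.sum_ite_eq, if_pos hi]
      · rw [sq, Finset.sum_mul_sum, Finset.mul_sum]
        simp_rw [Finset.mul_sum]
    have h4 : (∑ i ∈ s, ‖c i‖ * w i) ^ 2 ≤ Q := by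
      refine (Finset.sum_mul_sq_le_sq_mul_sq s _ _).trans ?_
      calc _ ≤ Q * 1 := mul_le_mul_of_nonneg_left hw hQ0
        _ = Q := mul_one Q
    have h5 := mul_le_mul_of_nonneg_left h4 hε
    linarith
  have h6 : Q ≤ ‖v‖ * ‖y‖ := by
    have := norm_inner_le_norm (𝕜 := 𝕜) v y
    rwa [hvy, RCLike.norm_ofReal, abs_of_nonneg hQ0] at this
  have h7 : Q * Q ≤ ((L + ε) * ‖y‖ ^ 2) * Q := by
    have := mul_self_le_mul_self hQ0 h6
    have h8 := mul_le_mul_of_nonneg_right hvn (sq_nonneg ‖y‖)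
    nlinarith
  rcases eq_or_lt_of_le hQ0 with h0 | h0
  · rw [← h0]; positivity
  · exact le_of_mul_le_mul_right h7 h0

variable [CompleteSpace H]

/-- The Gram matrix of the frame and its dual is an orthogonal projection, so a diagonal entry is
the squared norm of its row. Hence p² ≤ p for p = ⟨f_i, f̃_i⟩, which gives p ≤ 1 below. -/
theorem IsFrame.hasSum_realPairing {ι : Type*} {f : ι → H} (hf : IsFrame 𝕜 f) (i : ι) :
    HasSum (fun k => ‖inner 𝕜 (canonicalDual 𝕜 f i) (f k)‖ ^ 2) (realPairing 𝕜 f i) := by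
  have h1 := RCLike.hasSum_re 𝕜 (hf.hasSum_inner (f i) (canonicalDual 𝕜 f i))
  rw [inner_re_symm] at h1
  change HasSum _ (realPairing 𝕜 f i) at h1
  convert h1 using 2 with k
  rw [← hf.inner_canonicalDual_comm, ← inner_conj_symm (f k), RCLike.mul_conj]
  norm_cast

theorem IsFrame.realPairing_nonneg {ι : Type*} {f : ι → H} (hf : IsFrame 𝕜 f) (i : ι) :
    0 ≤ realPairing 𝕜 f i :=
  (hf.hasSum_realPairing i).nonneg fun _ => sq_nonneg _

theorem IsFrame.realPairing_le_one {ι : Type*} {f : ι → H} (hf : IsFrame 𝕜 f) (i : ι) :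
    realPairing 𝕜 f i ≤ 1 := by
  have h1 : ‖inner 𝕜 (canonicalDual 𝕜 f i) (f i)‖ ^ 2 ≤ realPairing 𝕜 f i :=
    le_hasSum (hf.hasSum_realPairing i) i fun _ _ => sq_nonneg _
  have h2 : realPairing 𝕜 f i ≤ ‖inner 𝕜 (canonicalDual 𝕜 f i) (f i)‖ := RCLike.re_le_norm _
  have h3 := hf.realPairing_nonneg i
  nlinarith

/-- The vector y = (T⁻¹)* b_i is biorthogonal to the f_k = T b_k, so S y = f_i and y is the dual
vector. -/
theorem IsRieszBasis.realPairing_eq_one {ι : Type*} {f : ι → H} (hf : IsFrame 𝕜 f)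
    (hR : IsRieszBasis 𝕜 f) (i : ι) : realPairing 𝕜 f i = 1 := by
  classical
  obtain ⟨b, T, hT⟩ := hR
  obtain ⟨C, S, hC, hop, hS, hd⟩ := hf.exists_frameOp_equiv
  set y : H := ContinuousLinearMap.adjoint (T.symm : H →L[𝕜] H) (b i) with hy
  have hin : ∀ x, inner 𝕜 (T x) y = inner 𝕜 x (b i) := fun x => by
    rw [hy, ContinuousLinearMap.adjoint_inner_right]
    simp
  have horth := orthonormal_iff_ite.1 b.orthonormal
  have h1 : S y = f i := by
    rw [← hop, frameOp, tsum_eq_single i]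
    · rw [hT, hin, horth, if_pos rfl, one_smul]
    · intro k hk
      rw [hT, hin, horth, if_neg hk, zero_smul]
  have h2 : canonicalDual 𝕜 f i = y := by rw [hd, ← h1, S.symm_apply_apply]
  rw [realPairing, h2, inner_re_symm, hT, hin, horth, if_pos rfl, RCLike.one_re]

/-- If infinitely many of the numbers `⟨f_i, f̃_i⟩` stay away from `1`, then infinitely many
elements can be removed from the frame. -/
theorem IsFrame.exists_infinite_removable {ι : Type*} {f : ι → H} (hf : IsFrame 𝕜 f) {L : ℝ}
    (hL : L < 1) (hinf : {i | realPairing 𝕜 f i ≤ L}.Infinite) :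
    ∃ J : Set ι, J.Infinite ∧ IsFrame 𝕜 (fun i : ↥Jᶜ => f i) := by
  classical
  obtain ⟨C, S, hC, hop, hS, hd⟩ := hf.exists_frameOp_equiv
  have hL0 : 0 ≤ L := by
    obtain ⟨i, hi⟩ := hinf.nonempty
    exact (hf.realPairing_nonneg i).trans hi
  -- Half the gap, so that L + ε < 1.
  set ε : ℝ := (1 - L) / 2 with hε
  have hε0 : 0 < ε := by rw [hε]; linarith
  -- The φ_i represent the coefficients: ⟨φ_i, Cx⟩ = ⟨f_i, x⟩, with ‖φ_i‖² the pairing, so a Bessel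
  -- bound for them is relative to ‖Cx‖² = Σ|⟨f_i, x⟩|².
  set φ : ι → lp (fun _ : ι => 𝕜) 2 := fun i => C (canonicalDual 𝕜 f i) with hφ
  have hφin : ∀ i x, inner 𝕜 (φ i) (C x) = inner 𝕜 (f i) x := fun i x => by
    rw [hφ, ← hS, hd, S.apply_symm_apply]
  have hφn : ∀ i, ‖φ i‖ ^ 2 = realPairing 𝕜 f i := fun i => by
    rw [← inner_self_eq_norm_sq (𝕜 := 𝕜), hφin, realPairing, inner_re_symm]
  have hsmall : ∀ i, ∀ δ : ℝ, 0 < δ → {k | ¬ ‖inner 𝕜 (φ i) (φ k)‖ ≤ δ}.Finite := by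
    intro i δ hδ
    have h1 := (hf.hasSum_realPairing i).summable.tendsto_cofinite_zero
    have h2 := h1.eventually (gt_mem_nhds (show (0 : ℝ) < δ ^ 2 by positivity))
    refine (h2.filter_mono le_rfl : ∀ᶠ k in cofinite, _).subset fun k hk => ?_
    simp only [Set.mem_ofPred_eq, not_le, not_lt, Set.mem_compl_iff] at hk ⊢
    rw [hφin, ← hf.inner_canonicalDual_comm] at hk
    exact pow_le_pow_left₀ hδ.le hk.le 2
  -- Greedy choice: each new index avoids the finitely many indices already used or insufficiently
  -- orthogonal to an earlier choice. The first component is a counter that fixes the weights.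
  obtain ⟨g, hgP, hgr⟩ := exists_seq_of_forall_finset_exists
    (fun z : ℕ × ι => realPairing 𝕜 f z.2 ≤ L)
    (fun z z' => z.1 < z'.1 ∧ z.2 ≠ z'.2 ∧
      ‖inner 𝕜 (φ z.2) (φ z'.2)‖ ≤ ε * ((1 / 2) ^ (z.1 + 1) * (1 / 2) ^ (z'.1 + 1))) (by
    intro s _
    set M : ℕ := s.sup Prod.fst + 1 with hM
    have hfin : (⋃ z ∈ s, ({z.2} ∪ {k | ¬ ‖inner 𝕜 (φ z.2) (φ k)‖ ≤
        ε * ((1 / 2) ^ (z.1 + 1) * (1 / 2) ^ (M + 1))})).Finite := by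
      refine s.finite_toSet.biUnion fun z _ => (Set.finite_singleton _).union ?_
      exact hsmall z.2 _ (by positivity)
    obtain ⟨i, hi, hi'⟩ := hinf.exists_notMem_finite hfin
    refine ⟨(M, i), hi, fun z hz => ?_⟩
    simp only [Set.mem_iUnion, Set.mem_union, Set.mem_singleton_iff, Set.mem_ofPred_eq,
      not_exists, not_or, not_not] at hi'
    refine ⟨Nat.lt_succ_of_le (Finset.le_sup (f := Prod.fst) hz), fun h => ?_, (hi' z hz).2⟩
    exact (hi' z hz).1 h.symm)
  have hmono : StrictMono fun m => (g m).1 := fun m m' h => (hgr m m' h).1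
  have hne : ∀ m m', m ≠ m' → (g m).2 ≠ (g m').2 := by
    intro m m' h
    rcases lt_or_gt_of_ne h with h | h
    · exact (hgr _ _ h).2.1
    · exact (hgr _ _ h).2.1.symm
  set u : ℕ → ι := fun m => (g m).2 with hu
  have hinj : Function.Injective u := fun m m' h => by
    by_contra hc
    exact hne m m' hc h
  have hoff : ∀ m m', m < m' →
      ‖inner 𝕜 (φ (u m)) (φ (u m'))‖ ≤ ε * ((1 / 2) ^ (m + 1) * (1 / 2) ^ (m' + 1)) := by
    intro m m' h
    refine (hgr m m' h).2.2.trans ?_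
    -- Counters increase strictly, so the m-th is at least m.
    have h1 : ∀ m, ((1 : ℝ) / 2) ^ ((g m).1 + 1) ≤ (1 / 2) ^ (m + 1) := fun m =>
      pow_le_pow_of_le_one (by norm_num) (by norm_num) (Nat.succ_le_succ (hmono.id_le m))
    exact mul_le_mul_of_nonneg_left
      (mul_le_mul (h1 m) (h1 m') (by positivity) (by positivity)) hε0.le
  have hbes : ∀ (s : Finset ℕ) (x : H),
      ∑ m ∈ s, ‖inner 𝕜 (f (u m)) x‖ ^ 2 ≤ (L + ε) * ‖C x‖ ^ 2 := by
    intro s x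
    simp_rw [← hφin]
    refine sum_norm_inner_sq_le_of_gram s (fun m => φ (u m)) (fun m => (1 / 2) ^ (m + 1)) hL0
      hε0.le (fun m _ => (hφn _).trans_le (hgP m)) (fun m _ m' _ h => ?_)
      (fun m _ => by positivity) ?_ (C x)
    · rcases lt_or_gt_of_ne h with h | h
      · exact hoff m m' h
      · rw [norm_inner_symm, mul_comm ((1 / 2 : ℝ) ^ (m + 1))]
        exact hoff m' m h
    · have h1 : Summable fun m : ℕ => (1 / 2 : ℝ) ^ (m + 1) :=
        (summable_nat_add_iff 1).2 (summable_geometric_of_lt_one (by norm_num) (by norm_num))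
      calc ∑ m ∈ s, ((1 / 2 : ℝ) ^ (m + 1)) ^ 2 ≤ ∑ m ∈ s, (1 / 2 : ℝ) ^ (m + 1) := by
            refine Finset.sum_le_sum fun m _ => ?_
            exact pow_le_of_le_one (by positivity)
              (pow_le_one₀ (by norm_num) (by norm_num)) (by norm_num)
        _ ≤ ∑' m : ℕ, (1 / 2 : ℝ) ^ (m + 1) := h1.sum_le_tsum _ fun m _ => by positivity
        _ = 1 := by
            simp_rw [pow_succ]
            rw [tsum_mul_right, tsum_geometric_of_lt_one (by norm_num) (by norm_num)]
            norm_num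
  refine ⟨Set.range u, Set.infinite_range_of_injective hinj, ?_⟩
  have hθ : 0 ≤ L + ε := by positivity
  have hθ1 : 0 < 1 - (L + ε) := by rw [hε]; linarith
  have hsum : ∀ x, ∑' i : Set.range u, ‖inner 𝕜 (f i) x‖ₑ ^ 2 ≤
      ENNReal.ofReal ((L + ε) * ‖C x‖ ^ 2) := by
    intro x
    rw [tsum_range (fun i => ‖inner 𝕜 (f i) x‖ₑ ^ 2) hinj, ENNReal.tsum_eq_iSup_sum]
    refine iSup_le fun s => ?_
    refine le_trans (le_of_eq ?_) (ENNReal.ofReal_le_ofReal (hbes s x))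
    rw [ENNReal.ofReal_sum_of_nonneg fun _ _ => sq_nonneg _]
    refine Finset.sum_congr rfl fun m _ => ?_
    rw [ENNReal.ofReal_pow (norm_nonneg _), ofReal_norm]
  have htot : ∀ x, ∑' i, ‖inner 𝕜 (f i) x‖ₑ ^ 2 = ENNReal.ofReal (‖C x‖ ^ 2) := by
    intro x
    rw [lp_norm_sq, ← tsum_enorm_sq_eq_ofReal (lp_summable_norm_sq _)]
    simp_rw [hC]
  obtain ⟨A, B, hA, hB, h⟩ := hf
  -- What remains after removing the range of u is at least (1 - (L + ε))‖Cx‖².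
  refine ⟨(1 - (L + ε)) * A, B, by positivity, hB, fun x => ⟨?_, ?_⟩⟩
  · have h1 := (h x).1
    rw [htot, ENNReal.ofReal_le_ofReal_iff (by positivity)] at h1
    have h2 := ENNReal.summable.tsum_add_tsum_compl (s := Set.range u)
      (f := fun i => ‖inner 𝕜 (f i) x‖ₑ ^ 2) ENNReal.summable
    rw [htot] at h2
    have h3 : ENNReal.ofReal (‖C x‖ ^ 2) ≤ ENNReal.ofReal ((L + ε) * ‖C x‖ ^ 2) +
        ∑' i : ↥(Set.range u)ᶜ, ‖inner 𝕜 (f i) x‖ₑ ^ 2 := by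
      rw [← h2]
      gcongr
      exact hsum x
    rw [← tsub_le_iff_left, ← ENNReal.ofReal_sub _ (by positivity)] at h3
    refine le_trans (ENNReal.ofReal_le_ofReal ?_) h3
    nlinarith
  · refine le_trans ?_ (h x).2
    exact ENNReal.tsum_comp_le_tsum_of_injective Subtype.val_injective _

end Pairing

/-! ### Geometry and growth of the boxes S_N(j). -/

section Boxes

variable {d e : ℕ} {n : Fin e → ℕ} (α : Fin d → ℝ)

theorem mem_box_iff {N : ℕ} {j k : RefGroup d n} :
    k ∈ box α N j ↔ (∀ i, |α i * ((k.1 i : ℝ) - j.1 i)| ≤ (N : ℝ) / 2) ∧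
      ∀ l, (if k.2 l = j.2 l then (0 : ℝ) else 1) ≤ (N : ℝ) / 2 := by
  have hN : (0 : ℝ) ≤ (N : ℝ) / 2 := by positivity
  have h1 : ∀ {m : ℕ} (v : Fin m → ℝ), (⨆ i, v i) ≤ (N : ℝ) / 2 ↔ ∀ i, v i ≤ (N : ℝ) / 2 :=
    fun v => ⟨fun h i => (le_ciSup (Set.finite_range v).bddAbove i).trans h,
      fun h => Real.iSup_le h hN⟩
  simp only [box, size, Set.mem_ofPred_eq, max_le_iff, h1, Prod.fst_sub, Prod.snd_sub,
    Pi.sub_apply, Int.cast_sub, sub_eq_zero]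

/-- Triangle inequality; it puts the decay box around a point of S_{N-M}(j) inside S_N(j). -/
theorem mem_box_trans {N M : ℕ} {j k m : RefGroup d n} (h : k ∈ box α N j)
    (h' : m ∈ box α M k) : m ∈ box α (N + M) j := by
  rw [mem_box_iff] at *
  have hN : (0 : ℝ) ≤ (N : ℝ) / 2 := by positivity
  have hM : (0 : ℝ) ≤ (M : ℝ) / 2 := by positivity
  refine ⟨fun i => ?_, fun l => ?_⟩
  · have h1 := h.1 i
    have h2 := h'.1 i
    have h3 := abs_add_le (α i * ((k.1 i : ℝ) - j.1 i)) (α i * ((m.1 i : ℝ) - k.1 i))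
    have h4 : α i * ((k.1 i : ℝ) - j.1 i) + α i * ((m.1 i : ℝ) - k.1 i) =
        α i * ((m.1 i : ℝ) - j.1 i) := by ring
    rw [h4] at h3
    push_cast
    linarith
  · have h1 := h.2 l
    have h2 := h'.2 l
    push_cast
    split_ifs at * with h3 h4 h5
    all_goals first | linarith | (exfalso; simp_all)

theorem self_mem_box (N : ℕ) (j : RefGroup d n) : j ∈ box α N j := by
  rw [mem_box_iff]
  have hN : (0 : ℝ) ≤ (N : ℝ) / 2 := by positivity
  simp [hN]

theorem box_mono {N M : ℕ} (h : N ≤ M) (j : RefGroup d n) : box α N j ⊆ box α M j := by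
  intro k hk
  have h1 : (N : ℝ) / 2 ≤ (M : ℝ) / 2 := by gcongr
  exact le_trans (show size α (k - j) ≤ _ from hk) h1

/-- Once N/2 ≥ 1 the torsion coordinates are unconstrained; hence the restriction on N. -/
theorem box_zero_eq (hα : ∀ i, 0 < α i) [∀ l, NeZero (n l)] {N : ℕ} (hN : 2 ≤ N) :
    box α N (0 : RefGroup d n) =
      ↑(Finset.Icc (fun i => -(⌊(α i)⁻¹ / 2 * (N : ℝ)⌋₊ : ℤ))
          (fun i => (⌊(α i)⁻¹ / 2 * (N : ℝ)⌋₊ : ℤ)) ×ˢ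
        (Finset.univ : Finset ((l : Fin e) → ZMod (n l)))) := by
  ext k
  have hN' : (1 : ℝ) ≤ (N : ℝ) / 2 := by
    have : (2 : ℝ) ≤ N := by exact_mod_cast hN
    linarith
  have h2 : ∀ l, (if k.2 l = 0 then (0 : ℝ) else 1) ≤ (N : ℝ) / 2 := fun l => by
    split_ifs <;> linarith
  rw [mem_box_iff]
  simp only [Finset.coe_product, Finset.coe_Icc, Finset.coe_univ, Set.mem_prod, Set.mem_univ,
    and_true, Set.mem_Icc, Pi.le_def, ← forall_and, Prod.fst_zero, Pi.zero_apply, Int.cast_zero,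
    sub_zero, Prod.snd_zero, h2, implies_true]
  refine forall_congr' fun i => ?_
  rw [← abs_le, abs_mul, abs_of_pos (hα i), Int.abs_eq_natAbs, Nat.cast_le,
    Nat.le_floor_iff (by have := hα i; positivity), Nat.cast_natAbs, Int.cast_abs]
  have := hα i
  rw [show (α i)⁻¹ / 2 * (N : ℝ) = (N / 2 : ℝ) / α i by field_simp, le_div_iff₀ this, mul_comm]

theorem box_finite (hα : ∀ i, 0 < α i) [∀ l, NeZero (n l)] (N : ℕ) (j : RefGroup d n) :
    (box α N j).Finite := by
  -- Enlarging to N + 2 makes the explicit description available.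
  have h1 : (box α (N + 2) (0 : RefGroup d n)).Finite := by
    rw [box_zero_eq α hα (show 2 ≤ N + 2 by omega)]
    exact Finset.finite_toSet _
  refine ((h1.image (· + j)).subset fun k hk => ⟨k - j, ?_, sub_add_cancel k j⟩)
  refine box_mono α (show N ≤ N + 2 by omega) 0 ?_
  show size α (k - j - 0) ≤ _
  rw [sub_zero]
  exact hk

/-- The common cardinality of the boxes of side `N`. -/
noncomputable def boxCard (n : Fin e → ℕ) (N : ℕ) : ℕ := (box α N (0 : RefGroup d n)).ncard

theorem ncard_box (N : ℕ) (j : RefGroup d n) : (box α N j).ncard = boxCard α n N := by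
  have h1 : box α N j = (· + j) '' box α N 0 := by
    ext k
    refine ⟨fun hk => ⟨k - j, ?_, sub_add_cancel k j⟩, ?_⟩
    · show size α (k - j - 0) ≤ _
      rw [sub_zero]
      exact hk
    · rintro ⟨m, hm, rfl⟩
      show size α (m + j - j) ≤ _
      rw [add_sub_cancel_right, ← sub_zero m]
      exact hm
  rw [h1, Set.ncard_image_of_injective _ (add_left_injective j), boxCard]

theorem boxCard_pos (hα : ∀ i, 0 < α i) [∀ l, NeZero (n l)] (N : ℕ) : 0 < boxCard α n N :=
  (Set.ncard_pos (box_finite α hα N 0)).2 ⟨0, self_mem_box α N 0⟩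

theorem boxCard_eq (hα : ∀ i, 0 < α i) [∀ l, NeZero (n l)] {N : ℕ} (hN : 2 ≤ N) :
    boxCard α n N = (∏ i, (2 * ⌊(α i)⁻¹ / 2 * N⌋₊ + 1)) * ∏ l, n l := by
  rw [boxCard, box_zero_eq α hα hN, Set.ncard_coe_finset, Finset.card_product, Pi.card_Icc,
    Finset.card_univ, Fintype.card_pi]
  congr 1
  · refine Finset.prod_congr rfl fun i _ => ?_
    rw [Int.card_Icc]
    omega
  · exact Finset.prod_congr rfl fun l _ => ZMod.card _

theorem tendsto_boxCard_div_pow (hα : ∀ i, 0 < α i) [∀ l, NeZero (n l)] :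
    Tendsto (fun N : ℕ => (boxCard α n N : ℝ) / (N : ℝ) ^ d) atTop
      (𝓝 ((∏ i, (α i)⁻¹) * ∏ l, (n l : ℝ))) := by
  have h1 : ∀ i, Tendsto (fun N : ℕ => (2 * (⌊(α i)⁻¹ / 2 * N⌋₊ : ℝ) + 1) / N) atTop
      (𝓝 ((α i)⁻¹)) := fun i => by
    have h2 := (tendsto_nat_floor_mul_div_atTop
      (show 0 ≤ (α i)⁻¹ / 2 by have := hα i; positivity)).comp tendsto_natCast_atTop_atTop
    have h3 := (h2.const_mul 2).add (tendsto_one_div_atTop_nhds_zero_nat (𝕜 := ℝ))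
    rw [add_zero, mul_div_cancel₀ _ two_ne_zero] at h3
    refine h3.congr fun N => ?_
    simp only [Function.comp_apply]
    ring
  have h4 := (tendsto_finsetProd Finset.univ fun i _ => h1 i).mul_const (∏ l, (n l : ℝ))
  refine h4.congr' ?_
  filter_upwards [eventually_ge_atTop 2] with N hN
  rw [boxCard_eq α hα hN, Finset.prod_div_distrib]
  push_cast
  rw [Finset.prod_const, Finset.card_univ, Fintype.card_fin]
  ring

/-- The Følner property of the boxes: a shell of fixed width is negligible, by growth of order N^d.
-/
theorem tendsto_boxCard_sub_div (hα : ∀ i, 0 < α i) [∀ l, NeZero (n l)] (M : ℕ) :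
    Tendsto (fun N : ℕ => (boxCard α n (N - M) : ℝ) / boxCard α n N) atTop (𝓝 1) := by
  have hc : (∏ i, (α i)⁻¹) * ∏ l, (n l : ℝ) ≠ 0 := by
    refine mul_ne_zero (Finset.prod_ne_zero_iff.2 fun i _ => (inv_pos.2 (hα i)).ne')
      (Finset.prod_ne_zero_iff.2 fun l _ => Nat.cast_ne_zero.2 (NeZero.ne _))
  have h1 := tendsto_boxCard_div_pow (n := n) α hα
  have h2 := h1.comp (tendsto_sub_atTop_nat M)
  have h3 : Tendsto (fun N : ℕ => (((N - M : ℕ) : ℝ) / N) ^ d) atTop (𝓝 1) := by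
    have h4 : Tendsto (fun N : ℕ => ((N - M : ℕ) : ℝ) / N) atTop (𝓝 1) := by
      have h5 := (tendsto_const_nhds (x := (1 : ℝ))).sub
        (tendsto_const_div_atTop_nhds_zero_nat (M : ℝ))
      rw [sub_zero] at h5
      refine h5.congr' ?_
      filter_upwards [eventually_ge_atTop M, eventually_gt_atTop 0] with N hN hN0
      have : (N : ℝ) ≠ 0 := by exact_mod_cast hN0.ne'
      rw [Nat.cast_sub hN]
      field_simp
    simpa using h4.pow d
  have h6 := (h2.div h1 hc).mul h3
  rw [div_self hc, one_mul] at h6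
  refine h6.congr' ?_
  filter_upwards [eventually_gt_atTop M] with N hN
  have h7 : ((N - M : ℕ) : ℝ) ≠ 0 := by
    have : N - M ≠ 0 := by omega
    exact_mod_cast this
  have h8 : (N : ℝ) ≠ 0 := by
    have : N ≠ 0 := by omega
    exact_mod_cast this
  have h9 : (boxCard α n N : ℝ) ≠ 0 := by exact_mod_cast (boxCard_pos α hα N).ne'
  simp only [Function.comp_apply, Pi.div_apply, div_pow]
  field_simp

theorem tendsto_boxCard_atTop (hd : 0 < d) (hα : ∀ i, 0 < α i) [∀ l, NeZero (n l)] :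
    Tendsto (fun N : ℕ => (boxCard α n N : ℝ)) atTop atTop := by
  have hc : 0 < (∏ i, (α i)⁻¹) * ∏ l, (n l : ℝ) := by
    refine mul_pos (Finset.prod_pos fun i _ => inv_pos.2 (hα i))
      (Finset.prod_pos fun l _ => Nat.cast_pos.2 (NeZero.pos _))
  have h1 := (tendsto_boxCard_div_pow (n := n) α hα).pos_mul_atTop hc
    ((tendsto_pow_atTop hd.ne').comp (tendsto_natCast_atTop_atTop (R := ℝ)))
  refine h1.congr' ?_
  filter_upwards [eventually_gt_atTop 0] with N hN
  have : (N : ℝ) ≠ 0 := by exact_mod_cast hN.ne'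
  simp only [Function.comp_apply]
  field_simp

end Boxes

/-! ### Row sums against column sums of a localized matrix. -/

section Comparison

variable {d e : ℕ} {n : Fin e → ℕ} (α : Fin d → ℝ) {ι κ : Type*}

theorem ncard_preimage_le {G : Type*} {a : ι → G} {K : ℕ} (hfin : ∀ g, (a ⁻¹' {g}).Finite)
    (hK : ∀ g, (a ⁻¹' {g}).ncard ≤ K) {Q : Set G} (hQ : Q.Finite) :
    (a ⁻¹' Q).ncard ≤ K * Q.ncard := by
  classical
  have hpre : (a ⁻¹' Q).Finite := hQ.preimage' fun g _ => hfin g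
  rw [Set.ncard_eq_toFinset_card _ hpre, Set.ncard_eq_toFinset_card _ hQ]
  refine Finset.card_le_mul_card_image_of_maps_to (f := a) (fun i hi => ?_) K fun g _ => ?_
  · simpa using hi
  · refine le_trans ?_ (hK g)
    rw [← Set.ncard_coe_finset]
    refine Set.ncard_le_ncard (fun i hi => ?_) (hfin g)
    simpa using (Finset.mem_filter.1 hi).2

theorem preBox_finite (hα : ∀ i, 0 < α i) [∀ l, NeZero (n l)] {a : ι → RefGroup d n}
    (hfin : ∀ g, (a ⁻¹' {g}).Finite) (N : ℕ) (j : RefGroup d n) : (preBox α a N j).Finite :=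
  (box_finite α hα N j).preimage' fun g _ => hfin g

theorem ncard_preBox_le (hα : ∀ i, 0 < α i) [∀ l, NeZero (n l)] {a : ι → RefGroup d n} {K : ℕ}
    (hfin : ∀ g, (a ⁻¹' {g}).Finite) (hK : ∀ g, (a ⁻¹' {g}).ncard ≤ K) (N : ℕ)
    (j : RefGroup d n) : (preBox α a N j).ncard ≤ K * boxCard α n N := by
  rw [← ncard_box α N j]
  exact ncard_preimage_le hfin hK (box_finite α hα N j)

theorem ncard_preBox_diff_le (hα : ∀ i, 0 < α i) [∀ l, NeZero (n l)] {a : ι → RefGroup d n}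
    {K : ℕ} (hfin : ∀ g, (a ⁻¹' {g}).Finite) (hK : ∀ g, (a ⁻¹' {g}).ncard ≤ K) {N M : ℕ}
    (hNM : M ≤ N) (j : RefGroup d n) :
    ((preBox α a N j \ preBox α a M j).ncard : ℝ) ≤ K * ((boxCard α n N : ℝ) - boxCard α n M) := by
  have h1 : (preBox α a N j \ preBox α a M j).ncard ≤ K * (box α N j \ box α M j).ncard :=
    ncard_preimage_le hfin hK ((box_finite α hα N j).sdiff)
  have h2 := Set.ncard_sdiff_add_ncard_of_subset (box_mono α hNM j) (box_finite α hα N j)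
  rw [ncard_box, ncard_box] at h2
  calc ((preBox α a N j \ preBox α a M j).ncard : ℝ) ≤ K * (box α N j \ box α M j).ncard := by
        exact_mod_cast h1
    _ = _ := by rw [← h2]; push_cast; ring

theorem abs_sub_sum_le_of_tsum_compl_le {u : κ → ℝ} {r δ : ℝ} (hu : HasSum u r) (hδ : 0 ≤ δ)
    (B : Finset κ) (h : ∑' k : ↥((B : Set κ)ᶜ), ‖u k‖ₑ ≤ ENNReal.ofReal δ) :
    |r - ∑ k ∈ B, u k| ≤ δ := by
  have h1 := hu.summable.sum_add_tsum_compl (s := B)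
  rw [hu.tsum_eq] at h1
  have h2 : r - ∑ k ∈ B, u k = ∑' k : ↥((B : Set κ)ᶜ), u k := by rw [← h1]; ring
  rw [h2, ← Real.norm_eq_abs]
  have h3 := enorm_tsum_le_tsum_enorm.trans h
  rwa [← ofReal_norm, ENNReal.ofReal_le_ofReal_iff hδ] at h3

/-- If the rows of `t` decay away from the box centred at the index of the row, then the sum of
the row sums over a large box is close to the sum of the corresponding block. -/
theorem eventually_rowSums_near_block (hα : ∀ i, 0 < α i) [∀ l, NeZero (n l)]
    {a : ι → RefGroup d n} {b : κ → RefGroup d n} {t : ι → κ → ℝ} {r : ι → ℝ}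
    (ht : ∀ i, HasSum (t i) (r i)) {K : ℕ} (hfin : ∀ g, (a ⁻¹' {g}).Finite)
    (hK : ∀ g, (a ⁻¹' {g}).ncard ≤ K) (hfa : ∀ N j, (preBox α a N j).Finite)
    (hfb : ∀ N j, (preBox α b N j).Finite) {C : ℝ} (hC : 0 ≤ C)
    (hbound : ∀ i, ∑' k, ‖t i k‖ₑ ≤ ENNReal.ofReal C)
    (hdecay : ∀ δ : ℝ, 0 < δ → ∃ N : ℕ, ∀ i,
      ∑' k : ↥(preBox α b N (a i))ᶜ, ‖t i k‖ₑ ≤ ENNReal.ofReal δ)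
    {ε : ℝ} (hε : 0 < ε) :
    ∀ᶠ N in atTop, ∀ j, |∑ i ∈ (hfa N j).toFinset, r i -
      ∑ i ∈ (hfa N j).toFinset, ∑ k ∈ (hfb N j).toFinset, t i k| ≤ ε * boxCard α n N := by
  classical
  -- Rows centred in S_{N-M}(j) number at most K|S_N| and each loses at most this tail: ε/2 in all.
  -- The `+ 1` covers K = 0.
  obtain ⟨M, hM⟩ := hdecay (ε / (2 * (K + 1))) (by positivity)
  -- The rows in the shell cost at most C each; this threshold makes their total at most the other
  -- ε/2.
  have h1 := (tendsto_boxCard_sub_div (n := n) α hα M).eventually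
    (lt_mem_nhds (show 1 - ε / (2 * (C + 1) * (K + 1)) < 1 by
      have : 0 < ε / (2 * (C + 1) * (K + 1)) := by positivity
      linarith))
  filter_upwards [h1, eventually_ge_atTop M] with N hN hMN j
  have hc : (0 : ℝ) < boxCard α n N := by exact_mod_cast boxCard_pos α hα N
  have hshell : (boxCard α n N : ℝ) - boxCard α n (N - M) ≤
      ε / (2 * (C + 1) * (K + 1)) * boxCard α n N := by
    rw [lt_div_iff₀ hc] at hN
    linarith
  have hrow : ∀ i ∈ (hfa N j).toFinset, |r i - ∑ k ∈ (hfb N j).toFinset, t i k| ≤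
      if i ∈ preBox α a (N - M) j then ε / (2 * (K + 1)) else C := by
    intro i _
    split_ifs with hi
    · refine abs_sub_sum_le_of_tsum_compl_le (ht i) (by positivity) _ (le_trans ?_ (hM i))
      refine ENNReal.tsum_mono_subtype (fun k => ‖t i k‖ₑ) fun k hk hk' => ?_
      apply hk
      rw [Set.Finite.coe_toFinset]
      have h2 := mem_box_trans α (show a i ∈ box α (N - M) j from hi)
        (show b k ∈ box α M (a i) from hk')
      rwa [Nat.sub_add_cancel hMN] at h2
    · refine abs_sub_sum_le_of_tsum_compl_le (ht i) hC _ (le_trans ?_ (hbound i))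
      exact ENNReal.tsum_comp_le_tsum_of_injective Subtype.val_injective _
  rw [← Finset.sum_sub_distrib]
  refine (Finset.abs_sum_le_sum_abs _ _).trans ((Finset.sum_le_sum hrow).trans ?_)
  rw [Finset.sum_ite, Finset.sum_const, Finset.sum_const, nsmul_eq_mul, nsmul_eq_mul]
  have h3 : (((hfa N j).toFinset.filter (· ∈ preBox α a (N - M) j)).card : ℝ) ≤
      K * boxCard α n N := by
    refine le_trans ?_ (show ((preBox α a N j).ncard : ℝ) ≤ _ by
      exact_mod_cast ncard_preBox_le α hα hfin hK N j)
    rw [Set.ncard_eq_toFinset_card _ (hfa N j)]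
    exact_mod_cast Finset.card_filter_le _ _
  have h4 : (((hfa N j).toFinset.filter (¬ · ∈ preBox α a (N - M) j)).card : ℝ) ≤
      K * ((boxCard α n N : ℝ) - boxCard α n (N - M)) := by
    refine le_trans (le_of_eq ?_) (ncard_preBox_diff_le α hα hfin hK (Nat.sub_le N M) j)
    rw [← Set.ncard_coe_finset]
    congr 2
    ext i
    simp
  have h5 : (K : ℝ) * (ε / (2 * (K + 1))) ≤ ε / 2 := by
    rw [← mul_div_assoc, div_le_div_iff₀ (by positivity) (by positivity)]
    nlinarith
  have h6 : (K : ℝ) * (ε / (2 * (C + 1) * (K + 1))) * C ≤ ε / 2 := by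
    rw [← mul_div_assoc, div_mul_eq_mul_div, div_le_div_iff₀ (by positivity) (by positivity)]
    have : (0 : ℝ) ≤ K := Nat.cast_nonneg K
    nlinarith [mul_nonneg hε.le hC, mul_nonneg hε.le this]
  have h7 := mul_le_mul_of_nonneg_right h3 (show 0 ≤ ε / (2 * ((K : ℝ) + 1)) by positivity)
  have h8 := mul_le_mul_of_nonneg_right
    (h4.trans (mul_le_mul_of_nonneg_left hshell (Nat.cast_nonneg K))) hC
  have h9 := mul_le_mul_of_nonneg_right h5 hc.le
  have h10 := mul_le_mul_of_nonneg_right h6 hc.le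
  linarith

/-- Two families indexed over `G` which are the row sums and the column sums of a localized matrix
have the same averages over large boxes, uniformly in the centres. -/
theorem eventually_rowSums_near_colSums (hα : ∀ i, 0 < α i) [∀ l, NeZero (n l)]
    {a : ι → RefGroup d n} {t : ι → RefGroup d n → ℝ} {r : ι → ℝ} {s : RefGroup d n → ℝ}
    (hr : ∀ i, HasSum (t i) (r i)) (hs : ∀ k, HasSum (fun i => t i k) (s k)) {K : ℕ}
    (hfin : ∀ g, (a ⁻¹' {g}).Finite) (hK : ∀ g, (a ⁻¹' {g}).ncard ≤ K)
    (hfa : ∀ N j, (preBox α a N j).Finite) (hfb : ∀ N (j : RefGroup d n), (preBox α id N j).Finite)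
    {C : ℝ} (hC : 0 ≤ C)
    (hrow : ∀ i, ∑' k, ‖t i k‖ₑ ≤ ENNReal.ofReal C)
    (hcol : ∀ k, ∑' i, ‖t i k‖ₑ ≤ ENNReal.ofReal C)
    (hrowdecay : ∀ δ : ℝ, 0 < δ → ∃ N : ℕ, ∀ i,
      ∑' k : ↥(preBox α id N (a i))ᶜ, ‖t i k‖ₑ ≤ ENNReal.ofReal δ)
    (hcoldecay : ∀ δ : ℝ, 0 < δ → ∃ N : ℕ, ∀ k,
      ∑' i : ↥(preBox α a N k)ᶜ, ‖t i k‖ₑ ≤ ENNReal.ofReal δ)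
    {ε : ℝ} (hε : 0 < ε) :
    ∀ᶠ N in atTop, ∀ j, |∑ i ∈ (hfa N j).toFinset, r i - ∑ k ∈ (hfb N j).toFinset, s k| ≤
      ε * boxCard α n N := by
  have h1 := eventually_rowSums_near_block α hα hr hfin hK hfa hfb hC hrow hrowdecay (half_pos hε)
  -- The transposed matrix, with rows indexed by G itself: fibres of `id` have one element.
  have h2 := eventually_rowSums_near_block (a := id) α hα hs (K := 1)
    (fun g => by simp) (fun g => by simp) hfb hfa hC hcol hcoldecay (half_pos hε)
  filter_upwards [h1, h2] with N h3 h4 j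
  have h5 := h3 j
  have h6 := h4 j
  rw [Finset.sum_comm, abs_sub_comm] at h6
  refine (abs_sub_le _ _ _).trans ((add_le_add h5 h6).trans (le_of_eq ?_))
  ring

end Comparison

/-! ### Localization of the matrix built from F and E. -/

section Localization

/-- Weighted Young inequality. A small weight on the bounded factor lets a small tail of the other
factor make the product small. -/
theorem mul_le_mul_sq_add_inv_mul_sq {δ : ℝ≥0∞} (h0 : δ ≠ 0) (h1 : δ ≠ ∞) (x y : ℝ≥0∞) :
    x * y ≤ δ * x ^ 2 + δ⁻¹ * y ^ 2 := by
  rcases le_total y (δ * x) with h | h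
  · refine le_add_right ?_
    calc x * y ≤ x * (δ * x) := by gcongr
      _ = δ * x ^ 2 := by ring
  · refine le_add_left ?_
    have h2 : x ≤ δ⁻¹ * y := by
      rw [mul_comm, ← div_eq_mul_inv, ENNReal.le_div_iff_mul_le (Or.inl h0) (Or.inl h1), mul_comm]
      exact h
    calc x * y ≤ (δ⁻¹ * y) * y := by gcongr
      _ = δ⁻¹ * y ^ 2 := by ring

theorem tsum_subtype_le_tsum {ι : Type*} (u : ι → ℝ≥0∞) (s : Set ι) :
    ∑' i : s, u i ≤ ∑' i, u i :=
  ENNReal.tsum_comp_le_tsum_of_injective Subtype.val_injective u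

theorem tsum_mul_le_ofReal {ι : Type*} {x y : ι → ℝ≥0∞} {A B δ : ℝ} (hδ : 0 < δ) (hA : 0 ≤ A)
    (hB : 0 ≤ B)
    (hx : ∑' i, x i ^ 2 ≤ ENNReal.ofReal A) (hy : ∑' i, y i ^ 2 ≤ ENNReal.ofReal B) :
    ∑' i, x i * y i ≤ ENNReal.ofReal (δ * A + δ⁻¹ * B) := by
  have h0 : ENNReal.ofReal δ ≠ 0 := (ENNReal.ofReal_pos.2 hδ).ne'
  refine (ENNReal.tsum_le_tsum fun i =>
    mul_le_mul_sq_add_inv_mul_sq h0 ENNReal.ofReal_ne_top (x i) (y i)).trans ?_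
  rw [ENNReal.tsum_add, ENNReal.tsum_mul_left, ENNReal.tsum_mul_left,
    ENNReal.ofReal_add (by positivity) (by positivity), ENNReal.ofReal_mul hδ.le,
    ENNReal.ofReal_mul (by positivity), ENNReal.ofReal_inv_of_pos hδ]
  gcongr

variable {𝕜 : Type*} [RCLike 𝕜] {H : Type*} [NormedAddCommGroup H] [InnerProductSpace 𝕜 H]
  [CompleteSpace H] {d e : ℕ} {n : Fin e → ℕ} {α : Fin d → ℝ}

/-- The sums of the numbers `⟨f_i, f̃_i⟩` and `⟨e_k, ẽ_k⟩` over boxes with the same centre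
differ by little compared with the volume of the box. -/
theorem eventually_pairingSums_near (hα : ∀ i, 0 < α i) [∀ l, NeZero (n l)] {I : Type*}
    {a : I → RefGroup d n} {F : I → H} {E : RefGroup d n → H} (hF : IsFrame 𝕜 F)
    (hE : IsFrame 𝕜 E) (hcol : ColumnDecay 𝕜 α a F E) (hrow : RowDecay 𝕜 α a F E) {K : ℕ}
    (hfin : ∀ g, (a ⁻¹' {g}).Finite) (hK : ∀ g, (a ⁻¹' {g}).ncard ≤ K)
    (hfa : ∀ N j, (preBox α a N j).Finite) (hfb : ∀ N (j : RefGroup d n), (preBox α id N j).Finite)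
    {ε : ℝ} (hε : 0 < ε) :
    ∀ᶠ N in atTop, ∀ j, |∑ i ∈ (hfa N j).toFinset, realPairing 𝕜 F i -
      ∑ k ∈ (hfb N j).toFinset, realPairing 𝕜 E k| ≤ ε * boxCard α n N := by
  obtain ⟨BF', hBF', hF'⟩ := hF.exists_bessel_dual
  obtain ⟨BE', hBE', hE'⟩ := hE.exists_bessel_dual
  obtain ⟨AF, BF, -, hBF, hFb⟩ := id hF
  obtain ⟨AE, BE, -, hBE, hEb⟩ := id hE
  have hFn := norm_le_of_bessel hBF fun x => (hFb x).2
  have hEn := norm_le_of_bessel hBE fun x => (hEb x).2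
  have hFn' := norm_le_of_bessel hBF' hF'
  have hEn' := norm_le_of_bessel hBE' hE'
  have hsymm : ∀ x y : H, ‖inner 𝕜 x y‖ₑ = ‖inner 𝕜 y x‖ₑ := fun x y => by
    rw [← ofReal_norm, norm_inner_symm, ofReal_norm]
  set t : I → RefGroup d n → ℝ := fun i k =>
    RCLike.re (inner 𝕜 (canonicalDual 𝕜 F i) (canonicalDual 𝕜 E k) * inner 𝕜 (E k) (F i)) with ht
  have htle : ∀ i k, ‖t i k‖ₑ ≤
      ‖inner 𝕜 (canonicalDual 𝕜 F i) (canonicalDual 𝕜 E k)‖ₑ * ‖inner 𝕜 (E k) (F i)‖ₑ := by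
    intro i k
    rw [← enorm_mul, ← ofReal_norm, ← ofReal_norm]
    exact ENNReal.ofReal_le_ofReal (RCLike.norm_re_le_norm _)
  have hr : ∀ i, HasSum (t i) (realPairing 𝕜 F i) := fun i =>
    RCLike.hasSum_re 𝕜 (hE.hasSum_inner (canonicalDual 𝕜 F i) (F i))
  -- Expanding e_k in `F` gives the complex conjugates of the terms in the row expansion; real parts
  -- agree.
  have hs : ∀ k, HasSum (fun i => t i k) (realPairing 𝕜 E k) := fun k => by
    have h1 := RCLike.hasSum_re 𝕜 (hF.hasSum_inner (canonicalDual 𝕜 E k) (E k))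
    change HasSum _ (realPairing 𝕜 E k) at h1
    convert h1 using 2 with i
    rw [ht, ← RCLike.conj_re, map_mul, inner_conj_symm, inner_conj_symm]
  have hr1 : ∀ i, ∑' k, ‖inner 𝕜 (canonicalDual 𝕜 F i) (canonicalDual 𝕜 E k)‖ₑ ^ 2 ≤
      ENNReal.ofReal (BE' * BF') := fun i => by
    simp_rw [hsymm (canonicalDual 𝕜 F i)]
    exact (hE' _).trans (ENNReal.ofReal_le_ofReal
      (mul_le_mul_of_nonneg_left (hFn' i) hBE'.le))
  have hc1 : ∀ k, ∑' i, ‖inner 𝕜 (canonicalDual 𝕜 F i) (canonicalDual 𝕜 E k)‖ₑ ^ 2 ≤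
      ENNReal.ofReal (BE' * BF') := fun k =>
    (hF' _).trans (ENNReal.ofReal_le_ofReal
      (by rw [mul_comm]; exact mul_le_mul_of_nonneg_right (hEn' k) hBF'.le))
  have hr2 : ∀ i, ∑' k, ‖inner 𝕜 (E k) (F i)‖ₑ ^ 2 ≤ ENNReal.ofReal (BE * BF) := fun i =>
    (hEb _).2.trans (ENNReal.ofReal_le_ofReal (mul_le_mul_of_nonneg_left (hFn i) hBE.le))
  have hc2 : ∀ k, ∑' i, ‖inner 𝕜 (E k) (F i)‖ₑ ^ 2 ≤ ENNReal.ofReal (BE * BF) := fun k => by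
    simp_rw [hsymm (E k)]
    exact (hFb _).2.trans (ENNReal.ofReal_le_ofReal
      (by rw [mul_comm]; exact mul_le_mul_of_nonneg_right (hEn k) hBF.le))
  set P := BE' * BF' with hP
  have hP0 : 0 < P := mul_pos hBE' hBF'
  -- With weight δ/(2P), the factor bounded by P contributes δ/2, and a decay tail of size
  -- (δ/(2P))(δ/2) contributes the other half.
  have hsplit : ∀ δ : ℝ, 0 < δ → δ / (2 * P) * P + (δ / (2 * P))⁻¹ * (δ / (2 * P) * (δ / 2)) = δ :=
    fun δ hδ => by field_simp; ring
  have hrowS : ∀ i (s : Set (RefGroup d n)) (δ : ℝ), 0 < δ →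
      ∑' k : s, ‖inner 𝕜 (E k) (F i)‖ₑ ^ 2 ≤ ENNReal.ofReal (δ / (2 * P) * (δ / 2)) →
      ∑' k : s, ‖t i k‖ₑ ≤ ENNReal.ofReal δ := fun i s δ hδ h => by
    rw [← hsplit δ hδ]
    exact (ENNReal.tsum_le_tsum fun k : s => htle i k).trans
      (tsum_mul_le_ofReal (by positivity) hP0.le (by positivity)
        ((tsum_subtype_le_tsum _ s).trans (hr1 i)) h)
  have hcolS : ∀ k (s : Set I) (δ : ℝ), 0 < δ →
      ∑' i : s, ‖inner 𝕜 (E k) (F i)‖ₑ ^ 2 ≤ ENNReal.ofReal (δ / (2 * P) * (δ / 2)) →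
      ∑' i : s, ‖t i k‖ₑ ≤ ENNReal.ofReal δ := fun k s δ hδ h => by
    rw [← hsplit δ hδ]
    exact (ENNReal.tsum_le_tsum fun i : s => htle i k).trans
      (tsum_mul_le_ofReal (by positivity) hP0.le (by positivity) ((tsum_subtype_le_tsum
        (fun i => ‖inner 𝕜 (canonicalDual 𝕜 F i) (canonicalDual 𝕜 E k)‖ₑ ^ 2) s).trans (hc1 k)) h)
  refine eventually_rowSums_near_colSums α hα hr hs hfin hK hfa hfb
    (C := 1 * P + 1⁻¹ * (BE * BF)) (by positivity) (fun i => ?_) (fun k => ?_)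
    (fun δ hδ => ?_) (fun δ hδ => ?_) hε
  · exact (ENNReal.tsum_le_tsum fun k => htle i k).trans
      (tsum_mul_le_ofReal one_pos hP0.le (by positivity) (hr1 i) (hr2 i))
  · exact (ENNReal.tsum_le_tsum fun i => htle i k).trans
      (tsum_mul_le_ofReal one_pos hP0.le (by positivity) (hc1 k) (hc2 k))
  · obtain ⟨N, -, hN⟩ := hrow (δ / (2 * P) * (δ / 2)) (by positivity)
    exact ⟨N, fun i => hrowS i (preBox α id N (a i))ᶜ δ hδ (hN i).le⟩
  · obtain ⟨N, -, hN⟩ := hcol (δ / (2 * P) * (δ / 2)) (by positivity)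
    exact ⟨N, fun k => hcolS k (preBox α a N k)ᶜ δ hδ (hN k).le⟩

end Localization

/-! ### Extremal limits as limits along free ultrafilters. -/

section UltrafilterLimits

variable {X β : Type*} [CompleteLinearOrder β] [TopologicalSpace β] [OrderTopology β]

theorem IsFree.le_atTop {p : Ultrafilter ℕ} (hp : IsFree p) : (p : Filter ℕ) ≤ atTop := by
  rw [← Nat.cofinite_eq_atTop]
  exact hp

theorem le_limsup_iSup_of_tendsto {p : Ultrafilter ℕ} (hp : IsFree p) {u : ℕ → X → β}
    {c : ℕ → X} {b : β} (h : Tendsto (fun N => u N (c N)) p (𝓝 b)) :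
    b ≤ limsup (fun N => ⨆ j, u N j) atTop := by
  rw [← h.limsup_eq]
  refine (limsup_le_limsup (Eventually.of_forall fun N => le_iSup (u N) (c N))).trans ?_
  exact limsup_le_limsup_of_le hp.le_atTop

theorem liminf_iInf_le_of_tendsto {p : Ultrafilter ℕ} (hp : IsFree p) {u : ℕ → X → β}
    {c : ℕ → X} {b : β} (h : Tendsto (fun N => u N (c N)) p (𝓝 b)) :
    liminf (fun N => ⨅ j, u N j) atTop ≤ b :=
  le_limsup_iSup_of_tendsto (β := βᵒᵈ) hp h

/-- The upper limit of suprema is the limit along some free ultrafilter for some centres. -/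
theorem exists_isFree_tendsto_limsup_iSup [DenselyOrdered β] [FirstCountableTopology β]
    [Nonempty X] (u : ℕ → X → β) :
    ∃ (p : Ultrafilter ℕ) (c : ℕ → X), IsFree p ∧
      Tendsto (fun N => u N (c N)) p (𝓝 (limsup (fun N => ⨆ j, u N j) atTop)) := by
  set U := limsup (fun N => ⨆ j, u N j) atTop with hU
  suffices h : ∃ (p : Ultrafilter ℕ) (c : ℕ → X), IsFree p ∧
      ∀ b < U, ∀ᶠ N in (p : Filter ℕ), b < u N (c N) by
    obtain ⟨p, c, hp, h⟩ := h
    refine ⟨p, c, hp, tendsto_order.2 ⟨h, fun b hb => ?_⟩⟩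
    have h1 : ∀ᶠ N in atTop, (⨆ j, u N j) < b := eventually_lt_of_limsup_lt hb
    filter_upwards [h1.filter_mono hp.le_atTop] with N hN
    exact (le_iSup (u N) (c N)).trans_lt hN
  rcases eq_bot_or_bot_lt U with h0 | h0
  · refine ⟨hyperfilter ℕ, fun _ => Classical.arbitrary X, hyperfilter_le_cofinite, fun b hb => ?_⟩
    rw [h0] at hb
    exact absurd hb not_lt_bot
  -- Take b m increasing to U and stages φ m at which some centre gives a value above b m. The
  -- ultrafilter lives on the range of φ, so the centres elsewhere do not matter.
  obtain ⟨b, -, hb, hbU⟩ := exists_seq_strictMono_tendsto' h0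
  have hfreq : ∀ m, ∃ᶠ N in atTop, ∃ j, b m < u N j := fun m =>
    (frequently_lt_of_lt_limsup (h := (hb m).2)).mono fun N hN => lt_iSup_iff.1 hN
  obtain ⟨φ, hφ, hφb⟩ := extraction_forall_of_frequently hfreq
  choose j hj using hφb
  refine ⟨Ultrafilter.of (map φ atTop), fun N => j (Function.invFun φ N), ?_, fun x hx => ?_⟩
  · refine (Ultrafilter.of_le _).trans ?_
    rw [Nat.cofinite_eq_atTop]
    exact hφ.tendsto_atTop
  · refine (Ultrafilter.of_le (map φ atTop) : _ ≤ _) ?_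
    rw [mem_map]
    filter_upwards [hbU.eventually (lt_mem_nhds hx)] with m hm
    simp only [Set.mem_preimage, Set.mem_ofPred_eq, Function.leftInverse_invFun hφ.injective m]
    exact hm.trans (hj m)

theorem exists_isFree_tendsto_liminf_iInf [DenselyOrdered β] [FirstCountableTopology β]
    [Nonempty X] (u : ℕ → X → β) :
    ∃ (p : Ultrafilter ℕ) (c : ℕ → X), IsFree p ∧
      Tendsto (fun N => u N (c N)) p (𝓝 (liminf (fun N => ⨅ j, u N j) atTop)) :=
  exists_isFree_tendsto_limsup_iSup (β := βᵒᵈ) u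

theorem pLim_eq {p : Ultrafilter ℕ} {u : ℕ → ℝ≥0∞} {b : ℝ≥0∞} (h : Tendsto u p (𝓝 b)) :
    pLim p u = b :=
  tendsto_nhds_unique (tendsto_pLim p u) h

end UltrafilterLimits

/-! ### Box averages and their uniform comparison. -/

section Averages

variable {𝕜 : Type*} [RCLike 𝕜] {H : Type*} [NormedAddCommGroup H] [InnerProductSpace 𝕜 H]
  [CompleteSpace H] {d e : ℕ} {n : Fin e → ℕ} {α : Fin d → ℝ} {I : Type*}

theorem boxDensity_eq (hα : ∀ i, 0 < α i) [∀ l, NeZero (n l)] {a : I → RefGroup d n}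
    (hfa : ∀ N j, (preBox α a N j).Finite) (N : ℕ) (j : RefGroup d n) :
    boxDensity α a N j = ((preBox α a N j).ncard : ℝ≥0∞) / (boxCard α n N : ℝ≥0∞) := by
  rw [boxDensity, ← (hfa N j).cast_ncard_eq, ← (box_finite α hα N j).cast_ncard_eq, ncard_box]
  rfl

theorem boxAverage_eq {a : I → RefGroup d n} {F : I → H} (hF : IsFrame 𝕜 F)
    (hfa : ∀ N j, (preBox α a N j).Finite) (N : ℕ) (j : RefGroup d n) :
    boxAverage 𝕜 α a F N j =
      ENNReal.ofReal (∑ i ∈ (hfa N j).toFinset, realPairing 𝕜 F i) /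
        ((preBox α a N j).ncard : ℝ≥0∞) := by
  rw [boxAverage, ← (hfa N j).cast_ncard_eq]
  congr 1
  have h1 : (preBox α a N j) = ↑(hfa N j).toFinset := (Set.Finite.coe_toFinset _).symm
  rw [ENNReal.ofReal_sum_of_nonneg fun i _ => hF.realPairing_nonneg i]
  simp_rw [← dualPairing_eq_ofReal]
  conv_lhs => rw [h1]
  exact Finset.tsum_subtype _ _

theorem boxAverage_le_one {a : I → RefGroup d n} {F : I → H} (hF : IsFrame 𝕜 F)
    (hfa : ∀ N j, (preBox α a N j).Finite) (N : ℕ) (j : RefGroup d n) :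
    boxAverage 𝕜 α a F N j ≤ 1 := by
  rw [boxAverage_eq hF hfa]
  refine ENNReal.div_le_of_le_mul ?_
  rw [one_mul, ← ENNReal.ofReal_natCast]
  refine ENNReal.ofReal_le_ofReal ?_
  refine (Finset.sum_le_card_nsmul _ _ 1 fun i _ => hF.realPairing_le_one i).trans (le_of_eq ?_)
  rw [Set.ncard_eq_toFinset_card _ (hfa N j), nsmul_eq_mul, mul_one]

theorem boxAverage_eq_one_of_rieszBasis {a : I → RefGroup d n} {F : I → H} (hF : IsFrame 𝕜 F)
    (hR : IsRieszBasis 𝕜 F) (hfa : ∀ N j, (preBox α a N j).Finite) {N : ℕ} {j : RefGroup d n}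
    (hne : (preBox α a N j).Nonempty) : boxAverage 𝕜 α a F N j = 1 := by
  rw [boxAverage_eq hF hfa, Finset.sum_congr rfl fun i _ => hR.realPairing_eq_one hF i,
    Finset.sum_const, nsmul_eq_mul, mul_one, Set.ncard_eq_toFinset_card _ (hfa N j),
    ENNReal.ofReal_natCast]
  refine ENNReal.div_self ?_ (ENNReal.natCast_ne_top _)
  have : 0 < (hfa N j).toFinset.card := Finset.card_pos.2 (by simpa using hne)
  exact_mod_cast this.ne'

/-- The factor |I_N(j)| cancels. For an empty box the density is 0, so the convention for its
average is harmless. -/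
theorem boxDensity_mul_boxAverage (hα : ∀ i, 0 < α i) [∀ l, NeZero (n l)]
    {a : I → RefGroup d n} {F : I → H} (hF : IsFrame 𝕜 F)
    (hfa : ∀ N j, (preBox α a N j).Finite) (N : ℕ) (j : RefGroup d n) :
    boxDensity α a N j * boxAverage 𝕜 α a F N j =
      ENNReal.ofReal (∑ i ∈ (hfa N j).toFinset, realPairing 𝕜 F i) /
        (boxCard α n N : ℝ≥0∞) := by
  rw [boxDensity_eq hα hfa, boxAverage_eq hF hfa]
  rcases Nat.eq_zero_or_pos (preBox α a N j).ncard with h0 | h0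
  · have h1 : (hfa N j).toFinset = ∅ := by
      rw [← Finset.card_eq_zero, ← Set.ncard_eq_toFinset_card _ (hfa N j), h0]
    simp [h0, h1]
  · have h2 : ((preBox α a N j).ncard : ℝ≥0∞) ≠ 0 := by exact_mod_cast h0.ne'
    rw [← ENNReal.mul_div_right_comm, ENNReal.mul_div_cancel h2 (ENNReal.natCast_ne_top _)]

/-- Finiteness of the upper density bounds the fibres of `a`. -/
theorem exists_fiber_bound (hα : ∀ i, 0 < α i) [∀ l, NeZero (n l)] {a : I → RefGroup d n}
    (hD : upperDensity α a < ∞) :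
    (∀ g, (a ⁻¹' {g}).Finite) ∧ ∃ K : ℕ, ∀ g, (a ⁻¹' {g}).ncard ≤ K := by
  obtain ⟨b, hb, hb'⟩ := exists_between hD
  -- One N suffices: the fibre over g lies in I_N(g), whose size is bounded uniformly in g.
  obtain ⟨N, hN⟩ := (eventually_lt_of_limsup_lt hb).exists
  have hc0 : ((boxCard α n N : ℕ) : ℝ≥0∞) ≠ 0 := by exact_mod_cast (boxCard_pos α hα N).ne'
  have h1 : ∀ g, ((preBox α a N g).encard : ℝ≥0∞) ≤ b * (boxCard α n N : ℝ≥0∞) := fun g => by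
    have h2 := (le_iSup (boxDensity α a N) g).trans hN.le
    rw [boxDensity, ← (box_finite α hα N g).cast_ncard_eq, ncard_box] at h2
    exact (ENNReal.div_le_iff_le_mul (Or.inl hc0) (Or.inl (ENNReal.natCast_ne_top _))).1 h2
  have h3 : b * (boxCard α n N : ℝ≥0∞) ≠ ∞ :=
    ENNReal.mul_ne_top hb'.ne (ENNReal.natCast_ne_top _)
  obtain ⟨K, hK⟩ := ENNReal.exists_nat_gt h3
  have h4 : ∀ g, (a ⁻¹' {g}).encard ≤ K := fun g => by
    have h5 : ((preBox α a N g).encard : ℝ≥0∞) ≤ ((K : ℕ∞) : ℝ≥0∞) := (h1 g).trans hK.le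
    rw [ENat.toENNReal_le] at h5
    refine (Set.encard_le_encard fun i hi => ?_).trans h5
    have hi' : a i = g := hi
    show a i ∈ box α N g
    rw [hi']
    exact self_mem_box α N g
  have hfin : ∀ g, (a ⁻¹' {g}).Finite := fun g => Set.finite_of_encard_le_coe (h4 g)
  refine ⟨hfin, K, fun g => ?_⟩
  have h6 := h4 g
  rw [← (hfin g).cast_ncard_eq] at h6
  exact_mod_cast h6

/-- Averages for `E` agree asymptotically, uniformly in the centres, with averages for `F`
multiplied by the density. -/
theorem eventually_boxAverage_near (hα : ∀ i, 0 < α i) [∀ l, NeZero (n l)]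
    {a : I → RefGroup d n} {F : I → H} {E : RefGroup d n → H} (hF : IsFrame 𝕜 F)
    (hE : IsFrame 𝕜 E) (hcol : ColumnDecay 𝕜 α a F E) (hrow : RowDecay 𝕜 α a F E)
    (hD : upperDensity α a < ∞) {ε : ℝ≥0∞} (hε : 0 < ε) :
    ∀ᶠ N in atTop, ∀ j,
      boxAverage 𝕜 α id E N j ≤ boxDensity α a N j * boxAverage 𝕜 α a F N j + ε ∧
      boxDensity α a N j * boxAverage 𝕜 α a F N j ≤ boxAverage 𝕜 α id E N j + ε := by
  obtain ⟨hfin, K, hK⟩ := exists_fiber_bound hα hD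
  have hfa := preBox_finite α hα hfin
  have hfb : ∀ N (j : RefGroup d n), (preBox α id N j).Finite := box_finite α hα
  obtain ⟨δ, hδ0, hδ⟩ : ∃ δ : ℝ, 0 < δ ∧ ENNReal.ofReal δ ≤ ε := by
    obtain ⟨δ, h1, h2⟩ := ENNReal.lt_iff_exists_nnreal_btwn.1 hε
    exact ⟨δ, by exact_mod_cast h1, by rw [ENNReal.ofReal_coe_nnreal]; exact h2.le⟩
  filter_upwards [eventually_pairingSums_near hα hF hE hcol hrow hfin hK hfa hfb hδ0] with N hN j
  have hc0 : ((boxCard α n N : ℕ) : ℝ≥0∞) ≠ 0 := by exact_mod_cast (boxCard_pos α hα N).ne'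
  have hct := ENNReal.natCast_ne_top (boxCard α n N)
  have key : ∀ x y : ℝ, 0 ≤ y → x ≤ y + δ * boxCard α n N →
      ENNReal.ofReal x / (boxCard α n N : ℝ≥0∞) ≤
        ENNReal.ofReal y / (boxCard α n N : ℝ≥0∞) + ε := by
    intro x y hy hxy
    refine le_trans ?_ (add_le_add_right hδ _)
    rw [ENNReal.div_le_iff_le_mul (Or.inl hc0) (Or.inl hct), add_mul,
      ENNReal.div_mul_cancel hc0 hct]
    refine (ENNReal.ofReal_le_ofReal hxy).trans (le_of_eq ?_)
    rw [ENNReal.ofReal_add hy (by positivity), ENNReal.ofReal_mul hδ0.le, ENNReal.ofReal_natCast]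
  have h1 := abs_le.1 (hN j)
  have h2 : (preBox α id N j).ncard = boxCard α n N := ncard_box α N j
  rw [boxDensity_mul_boxAverage hα hF hfa, boxAverage_eq hE hfb, h2]
  refine ⟨key _ _ (Finset.sum_nonneg fun i _ => hF.realPairing_nonneg i) ?_,
    key _ _ (Finset.sum_nonneg fun i _ => hE.realPairing_nonneg i) ?_⟩ <;> linarith [h1.1, h1.2]

end Averages

/-! ### Relations between densities and measures. -/

section Densities

variable {d e : ℕ} {n : Fin e → ℕ} {α : Fin d → ℝ} {I : Type*}

theorem density_le_upperDensity (a : I → RefGroup d n) {p : Ultrafilter ℕ} (hp : IsFree p)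
    (c : ℕ → RefGroup d n) : density α a p c ≤ upperDensity α a :=
  le_limsup_iSup_of_tendsto hp (tendsto_pLim p _)

theorem lowerDensity_le_density (a : I → RefGroup d n) {p : Ultrafilter ℕ} (hp : IsFree p)
    (c : ℕ → RefGroup d n) : lowerDensity α a ≤ density α a p c :=
  liminf_iInf_le_of_tendsto hp (tendsto_pLim p _)

variable {𝕜 : Type*} [RCLike 𝕜] {H : Type*} [NormedAddCommGroup H] [InnerProductSpace 𝕜 H]

theorem frameMeasure_le_upperMeasure (a : I → RefGroup d n) (F : I → H) {p : Ultrafilter ℕ}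
    (hp : IsFree p) (c : ℕ → RefGroup d n) :
    frameMeasure 𝕜 α a F p c ≤ upperMeasure 𝕜 α a F :=
  le_limsup_iSup_of_tendsto hp (tendsto_pLim p _)

theorem lowerMeasure_le_frameMeasure (a : I → RefGroup d n) (F : I → H) {p : Ultrafilter ℕ}
    (hp : IsFree p) (c : ℕ → RefGroup d n) :
    lowerMeasure 𝕜 α a F ≤ frameMeasure 𝕜 α a F p c :=
  liminf_iInf_le_of_tendsto hp (tendsto_pLim p _)

theorem exists_density_eq_upperDensity (a : I → RefGroup d n) :
    ∃ (p : Ultrafilter ℕ) (c : ℕ → RefGroup d n), IsFree p ∧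
      density α a p c = upperDensity α a := by
  obtain ⟨p, c, hp, h⟩ := exists_isFree_tendsto_limsup_iSup (boxDensity α a)
  exact ⟨p, c, hp, pLim_eq h⟩

theorem exists_density_eq_lowerDensity (a : I → RefGroup d n) :
    ∃ (p : Ultrafilter ℕ) (c : ℕ → RefGroup d n), IsFree p ∧
      density α a p c = lowerDensity α a := by
  obtain ⟨p, c, hp, h⟩ := exists_isFree_tendsto_liminf_iInf (boxDensity α a)
  exact ⟨p, c, hp, pLim_eq h⟩

theorem exists_frameMeasure_eq_upperMeasure (a : I → RefGroup d n) (F : I → H) :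
    ∃ (p : Ultrafilter ℕ) (c : ℕ → RefGroup d n), IsFree p ∧
      frameMeasure 𝕜 α a F p c = upperMeasure 𝕜 α a F := by
  obtain ⟨p, c, hp, h⟩ := exists_isFree_tendsto_limsup_iSup (boxAverage 𝕜 α a F)
  exact ⟨p, c, hp, pLim_eq h⟩

theorem exists_frameMeasure_eq_lowerMeasure (a : I → RefGroup d n) (F : I → H) :
    ∃ (p : Ultrafilter ℕ) (c : ℕ → RefGroup d n), IsFree p ∧
      frameMeasure 𝕜 α a F p c = lowerMeasure 𝕜 α a F := by
  obtain ⟨p, c, hp, h⟩ := exists_isFree_tendsto_liminf_iInf (boxAverage 𝕜 α a F)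
  exact ⟨p, c, hp, pLim_eq h⟩

theorem lowerMeasure_eq_one {a : I → RefGroup d n} {F : I → H}
    (h : ∀ᶠ N in atTop, ∀ j, boxAverage 𝕜 α a F N j = 1) : lowerMeasure 𝕜 α a F = 1 := by
  rw [lowerMeasure, liminf_congr (v := fun _ => (1 : ℝ≥0∞)), liminf_const]
  filter_upwards [h] with N hN
  simp [hN]

theorem upperMeasure_eq_one {a : I → RefGroup d n} {F : I → H}
    (h : ∀ᶠ N in atTop, ∀ j, boxAverage 𝕜 α a F N j = 1) : upperMeasure 𝕜 α a F = 1 := by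
  rw [upperMeasure, limsup_congr (v := fun _ => (1 : ℝ≥0∞)), limsup_const]
  filter_upwards [h] with N hN
  simp [hN]

variable [CompleteSpace H]

theorem upperMeasure_le_one {a : I → RefGroup d n} {F : I → H} (hF : IsFrame 𝕜 F)
    (hfa : ∀ N j, (preBox α a N j).Finite) : upperMeasure 𝕜 α a F ≤ 1 := by
  refine limsup_le_of_le (h := Eventually.of_forall fun N => ?_)
  exact iSup_le fun j => boxAverage_le_one hF hfa N j

theorem frameMeasure_le_one {a : I → RefGroup d n} {F : I → H} (hF : IsFrame 𝕜 F)
    (hfa : ∀ N j, (preBox α a N j).Finite) {p : Ultrafilter ℕ} (hp : IsFree p)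
    (c : ℕ → RefGroup d n) : frameMeasure 𝕜 α a F p c ≤ 1 :=
  (frameMeasure_le_upperMeasure a F hp c).trans (upperMeasure_le_one hF hfa)

/-- The relation `M(E; p, c) = D(p, c) M(F; p, c)` between density and measures. -/
theorem frameMeasure_eq_density_mul (hα : ∀ i, 0 < α i) [∀ l, NeZero (n l)]
    {a : I → RefGroup d n} {F : I → H} {E : RefGroup d n → H} (hF : IsFrame 𝕜 F)
    (hE : IsFrame 𝕜 E) (hcol : ColumnDecay 𝕜 α a F E) (hrow : RowDecay 𝕜 α a F E)
    (hD : upperDensity α a < ∞) {p : Ultrafilter ℕ} (hp : IsFree p) (c : ℕ → RefGroup d n) :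
    frameMeasure 𝕜 α id E p c = density α a p c * frameMeasure 𝕜 α a F p c := by
  have hfa := preBox_finite α hα (exists_fiber_bound hα hD).1
  -- Both limits must be finite for multiplication on [0, ∞] to be continuous there.
  have h1 : density α a p c ≠ ∞ := ((density_le_upperDensity a hp c).trans_lt hD).ne
  have h2 : frameMeasure 𝕜 α a F p c ≠ ∞ :=
    ((frameMeasure_le_one hF hfa hp c).trans_lt ENNReal.one_lt_top).ne
  have hv := tendsto_pLim p fun N => boxAverage 𝕜 α id E N (c N)
  have huw := ENNReal.Tendsto.mul (tendsto_pLim p fun N => boxDensity α a N (c N)) (Or.inr h2)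
    (tendsto_pLim p fun N => boxAverage 𝕜 α a F N (c N)) (Or.inr h1)
  have hnear : ∀ ε : ℝ≥0∞, 0 < ε → _ := fun ε hε =>
    (eventually_boxAverage_near hα hF hE hcol hrow hD hε).filter_mono hp.le_atTop
  refine le_antisymm ?_ ?_ <;>
    refine ENNReal.le_of_forall_pos_le_add fun ε hε _ => ?_
  · exact le_of_tendsto_of_tendsto hv (huw.add_const _)
      ((hnear ε (by exact_mod_cast hε)).mono fun N h => (h (c N)).1)
  · exact le_of_tendsto_of_tendsto huw (hv.add_const _)
      ((hnear ε (by exact_mod_cast hε)).mono fun N h => (h (c N)).2)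

/-- If the averages along some centres with positive density have limit less than one, then
infinitely many of the numbers `⟨f_i, f̃_i⟩` stay away from `1`. -/
theorem exists_infinite_realPairing_le (hd : 0 < d) (hα : ∀ i, 0 < α i) [∀ l, NeZero (n l)]
    {a : I → RefGroup d n} {F : I → H} (hF : IsFrame 𝕜 F)
    (hfa : ∀ N j, (preBox α a N j).Finite) {p : Ultrafilter ℕ} (hp : IsFree p)
    {c : ℕ → RefGroup d n} (hpos : 0 < density α a p c) (hlt : frameMeasure 𝕜 α a F p c < 1) :
    ∃ L : ℝ, L < 1 ∧ {i | realPairing 𝕜 F i ≤ L}.Infinite := by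
  classical
  obtain ⟨M, hM, hM1⟩ := ENNReal.lt_iff_exists_nnreal_btwn.1 hlt
  obtain ⟨D, hD0, hD⟩ := ENNReal.lt_iff_exists_nnreal_btwn.1 hpos
  have hM1' : (M : ℝ) < 1 := by exact_mod_cast hM1
  have hD0' : (0 : ℝ) < D := by exact_mod_cast hD0
  obtain ⟨L, hML, hL⟩ := exists_between hM1'
  have hL0 : 0 ≤ L := M.coe_nonneg.trans hML.le
  refine ⟨L, hL, fun hfin => ?_⟩
  set k : ℕ := hfin.toFinset.card with hk
  have h1 := (tendsto_pLim p fun N => boxAverage 𝕜 α a F N (c N)).eventually (gt_mem_nhds hM)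
  have h2 := (tendsto_pLim p fun N => boxDensity α a N (c N)).eventually (lt_mem_nhds hD)
  -- If only k pairings were at most L, the sum over m indices would be at least L(m - k) and below
  -- M m, forcing (L - M)m < L k. Since m > D|S_N|, this threshold on |S_N| contradicts it.
  have h3 := ((tendsto_boxCard_atTop (n := n) α hd hα).eventually
    (eventually_gt_atTop (L * k / (L - M) / D))).filter_mono hp.le_atTop
  obtain ⟨N, h1, h2, h3⟩ := (h1.and (h2.and h3)).exists
  have hML' : 0 < L - M := by linarith
  rw [div_div, div_lt_iff₀ (by positivity)] at h3
  have hc0 : 0 < boxCard α n N := boxCard_pos α hα N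
  set m : ℕ := (preBox α a N (c N)).ncard with hm
  have h4 : (D : ℝ) * boxCard α n N < m := by
    rw [boxDensity_eq hα hfa, ENNReal.lt_div_iff_mul_lt (Or.inl (by exact_mod_cast hc0.ne'))
      (Or.inl (ENNReal.natCast_ne_top _))] at h2
    have h5 : D * (boxCard α n N : NNReal) < (m : NNReal) := by exact_mod_cast h2
    exact_mod_cast h5
  have hm0 : 0 < m := by
    have : (0 : ℝ) < m := lt_of_le_of_lt (by positivity) h4
    exact_mod_cast this
  have h6 : ∑ i ∈ (hfa N (c N)).toFinset, realPairing 𝕜 F i < M * m := by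
    rw [boxAverage_eq hF hfa, ENNReal.div_lt_iff (Or.inl (by exact_mod_cast hm0.ne'))
      (Or.inl (ENNReal.natCast_ne_top _)), ← ENNReal.ofReal_natCast, ← ENNReal.ofReal_coe_nnreal,
      ← ENNReal.ofReal_mul M.coe_nonneg] at h1
    exact lt_of_not_ge fun hcon => absurd h1 (not_lt.2 (ENNReal.ofReal_le_ofReal hcon))
  have h7 : L * ((m : ℝ) - k) ≤ ∑ i ∈ (hfa N (c N)).toFinset, realPairing 𝕜 F i := by
    calc L * ((m : ℝ) - k) ≤ L * (((hfa N (c N)).toFinset \ hfin.toFinset).card : ℝ) := by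
          refine mul_le_mul_of_nonneg_left ?_ hL0
          have h8 := Finset.le_card_sdiff hfin.toFinset (hfa N (c N)).toFinset
          rw [← Set.ncard_eq_toFinset_card _ (hfa N (c N)), ← hm, ← hk,
            tsub_le_iff_right] at h8
          rw [sub_le_iff_le_add]
          exact_mod_cast h8
      _ ≤ ∑ i ∈ (hfa N (c N)).toFinset \ hfin.toFinset, realPairing 𝕜 F i := by
          rw [mul_comm, ← nsmul_eq_mul]
          refine Finset.card_nsmul_le_sum _ _ _ fun i hi => ?_
          have h9 := (Finset.mem_sdiff.1 hi).2
          rw [Set.Finite.mem_toFinset, Set.mem_ofPred_eq, not_le] at h9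
          exact h9.le
      _ ≤ _ := Finset.sum_le_sum_of_subset_of_nonneg Finset.sdiff_subset
          fun i _ _ => hF.realPairing_nonneg i
  nlinarith

theorem exists_infinite_removable_of_upperMeasure_lt (hd : 0 < d) (hα : ∀ i, 0 < α i)
    [∀ l, NeZero (n l)] {a : I → RefGroup d n} {F : I → H} {E : RefGroup d n → H}
    (hF : IsFrame 𝕜 F) (hE : IsFrame 𝕜 E) (hcol : ColumnDecay 𝕜 α a F E)
    (hrow : RowDecay 𝕜 α a F E) (hD : upperDensity α a < ∞)
    (hlt : upperMeasure 𝕜 α id E < upperDensity α a) :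
    ∃ J : Set I, J.Infinite ∧ IsFrame 𝕜 (fun i : ↥Jᶜ => F i) := by
  obtain ⟨p, c, hp, hpc⟩ := exists_density_eq_upperDensity (α := α) a
  have hpos : 0 < density α a p c := hpc ▸ (zero_le.trans_lt hlt)
  -- Otherwise D⁺ = D(p, c) ≤ M(E; p, c) ≤ M⁺(E).
  have h1 : frameMeasure 𝕜 α a F p c < 1 := by
    by_contra hcon
    rw [not_lt] at hcon
    refine absurd hlt (not_lt.2 ?_)
    calc upperDensity α a = density α a p c * 1 := by rw [mul_one, hpc]
      _ ≤ density α a p c * frameMeasure 𝕜 α a F p c := by gcongr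
      _ = frameMeasure 𝕜 α id E p c :=
        (frameMeasure_eq_density_mul hα hF hE hcol hrow hD hp c).symm
      _ ≤ upperMeasure 𝕜 α id E := frameMeasure_le_upperMeasure id E hp c
  obtain ⟨L, hL, hinf⟩ := exists_infinite_realPairing_le hd hα hF
    (preBox_finite α hα (exists_fiber_bound hα hD).1) hp hpos h1
  exact hF.exists_infinite_removable hL hinf

/-- The averages of a Riesz basis are eventually `1` if the lower density is positive. -/
theorem eventually_boxAverage_eq_one {a : I → RefGroup d n} {F : I → H} (hF : IsFrame 𝕜 F)
    (hR : IsRieszBasis 𝕜 F) (hfa : ∀ N j, (preBox α a N j).Finite)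
    (hpos : 0 < lowerDensity α a) : ∀ᶠ N in atTop, ∀ j, boxAverage 𝕜 α a F N j = 1 := by
  filter_upwards [eventually_lt_of_lt_liminf hpos] with N hN j
  refine boxAverage_eq_one_of_rieszBasis hF hR hfa ?_
  rw [Set.nonempty_iff_ne_empty]
  intro h0
  have h1 : boxDensity α a N j = 0 := by rw [boxDensity, h0]; simp
  exact absurd (hN.trans_le (iInf_le _ j)) (by rw [h1]; exact lt_irrefl 0)

end Densities

end FrameDensity

/-! ### The density theorem. -/

open FrameDensity
theorem theorem3p4
    {𝕜 : Type*} [RCLike 𝕜]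
    {H : Type*} [NormedAddCommGroup H] [InnerProductSpace 𝕜 H] [CompleteSpace H]
    [TopologicalSpace.SeparableSpace H]
    -- the reference group `G = ∏ α_i ℤ × ∏ ℤ_{n_l}`, with at least one infinite factor
    {d e : ℕ} (hd : 0 < d) (α : Fin d → ℝ) (hα : ∀ i, 0 < α i)
    (n : Fin e → ℕ) (hn : ∀ l, 0 < n l)
    -- the index set `I` with its map `a : I → G`, and the frames `F = (F i)`, `E = (E j)`
    {I : Type*} [Countable I] (a : I → RefGroup d n)
    (F : I → H) (E : RefGroup d n → H)
    (hF : IsFrame 𝕜 F) (hE : IsFrame 𝕜 E)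
    (hD : upperDensity α a < ⊤)
    (hcol : ColumnDecay 𝕜 α a F E) (hrow : RowDecay 𝕜 α a F E) :
    -- (a)
    (∀ (p : Ultrafilter ℕ) (c : ℕ → RefGroup d n), IsFree p →
      frameMeasure 𝕜 α id E p c = density α a p c * frameMeasure 𝕜 α a F p c) ∧
    (lowerMeasure 𝕜 α id E ≤ upperDensity α a * lowerMeasure 𝕜 α a F ∧
      upperDensity α a * lowerMeasure 𝕜 α a F ≤ upperMeasure 𝕜 α id E) ∧
    (lowerMeasure 𝕜 α id E ≤ lowerDensity α a * upperMeasure 𝕜 α a F ∧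
      lowerDensity α a * upperMeasure 𝕜 α a F ≤ upperMeasure 𝕜 α id E) ∧
    -- (b)
    (upperMeasure 𝕜 α id E < upperDensity α a →
      ∃ J : Set I, J.Infinite ∧ IsFrame 𝕜 (fun i : ↥Jᶜ => F i)) ∧
    (IsRieszBasis 𝕜 E →
      -- (c)
      (∀ (p : Ultrafilter ℕ) (c : ℕ → RefGroup d n), IsFree p →
        frameMeasure 𝕜 α a F p c = 1 / density α a p c) ∧
      lowerMeasure 𝕜 α a F = 1 / upperDensity α a ∧
      upperMeasure 𝕜 α a F = 1 / lowerDensity α a ∧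
      -- (d)
      1 ≤ lowerDensity α a ∧
      -- (e)
      (1 < upperDensity α a →
        ∃ J : Set I, J.Infinite ∧ IsFrame 𝕜 (fun i : ↥Jᶜ => F i)) ∧
      -- (f)
      (IsRieszBasis 𝕜 F →
        lowerDensity α a = 1 ∧ upperDensity α a = 1 ∧
        lowerMeasure 𝕜 α a F = 1 ∧ upperMeasure 𝕜 α a F = 1 ∧
        ∀ (p : Ultrafilter ℕ) (c : ℕ → RefGroup d n), IsFree p →
          density α a p c = 1 ∧ frameMeasure 𝕜 α a F p c = 1)) := by
  have : ∀ l, NeZero (n l) := fun l => ⟨(hn l).ne'⟩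
  have hfa := preBox_finite α hα (exists_fiber_bound hα hD).1
  have hA : ∀ (p : Ultrafilter ℕ) (c : ℕ → RefGroup d n), IsFree p →
      frameMeasure 𝕜 α id E p c = density α a p c * frameMeasure 𝕜 α a F p c :=
    fun p c hp => frameMeasure_eq_density_mul hα hF hE hcol hrow hD hp c
  -- Each of the four inequalities evaluates the identity along centres that realise one factor and
  -- bounds the other factor there.
  have hI1 : lowerMeasure 𝕜 α id E ≤ upperDensity α a * lowerMeasure 𝕜 α a F := by
    obtain ⟨p, c, hp, h⟩ := exists_frameMeasure_eq_lowerMeasure (𝕜 := 𝕜) (α := α) a F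
    rw [← h]
    refine (lowerMeasure_le_frameMeasure id E hp c).trans ((hA p c hp).trans_le ?_)
    gcongr
    exact density_le_upperDensity a hp c
  have hI2 : upperDensity α a * lowerMeasure 𝕜 α a F ≤ upperMeasure 𝕜 α id E := by
    obtain ⟨p, c, hp, h⟩ := exists_density_eq_upperDensity (α := α) a
    rw [← h]
    refine le_trans ?_ ((hA p c hp).symm.trans_le (frameMeasure_le_upperMeasure id E hp c))
    gcongr
    exact lowerMeasure_le_frameMeasure a F hp c
  have hI3 : lowerMeasure 𝕜 α id E ≤ lowerDensity α a * upperMeasure 𝕜 α a F := by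
    obtain ⟨p, c, hp, h⟩ := exists_density_eq_lowerDensity (α := α) a
    rw [← h]
    refine (lowerMeasure_le_frameMeasure id E hp c).trans ((hA p c hp).trans_le ?_)
    gcongr
    exact frameMeasure_le_upperMeasure a F hp c
  have hI4 : lowerDensity α a * upperMeasure 𝕜 α a F ≤ upperMeasure 𝕜 α id E := by
    obtain ⟨p, c, hp, h⟩ := exists_frameMeasure_eq_upperMeasure (𝕜 := 𝕜) (α := α) a F
    rw [← h]
    refine le_trans ?_ ((hA p c hp).symm.trans_le (frameMeasure_le_upperMeasure id E hp c))
    gcongr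
    exact lowerDensity_le_density a hp c
  have hB := exists_infinite_removable_of_upperMeasure_lt hd hα hF hE hcol hrow hD
  refine ⟨hA, ⟨hI1, hI2⟩, ⟨hI3, hI4⟩, hB, fun hER => ?_⟩
  have hE1 : ∀ᶠ N in Filter.atTop, ∀ j, boxAverage 𝕜 α id E N j = 1 :=
    Filter.Eventually.of_forall fun N j => boxAverage_eq_one_of_rieszBasis hE hER
      (box_finite α hα) ⟨j, self_mem_box α N j⟩
  have hEl := lowerMeasure_eq_one hE1
  have hEu := upperMeasure_eq_one hE1
  have hEp : ∀ (p : Ultrafilter ℕ) (c : ℕ → RefGroup d n), IsFree p →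
      frameMeasure 𝕜 α id E p c = 1 := fun p c hp =>
    le_antisymm (hEu ▸ frameMeasure_le_upperMeasure id E hp c)
      (hEl ▸ lowerMeasure_le_frameMeasure id E hp c)
  rw [hEl] at hI1 hI3
  rw [hEu] at hI2 hI4
  have hFu := upperMeasure_le_one hF hfa
  have hdl : 1 ≤ lowerDensity α a := by
    refine hI3.trans ?_
    calc lowerDensity α a * upperMeasure 𝕜 α a F ≤ lowerDensity α a * 1 := by gcongr
      _ = lowerDensity α a := mul_one _
  refine ⟨fun p c hp => ?_, ?_, ?_, hdl, fun h => hB (hEu ▸ h), fun hFR => ?_⟩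
  -- A product equal to 1 in [0, ∞] excludes 0 and ∞, so the reciprocal is genuine.
  · exact ENNReal.eq_inv_of_mul_eq_one_left (by rw [mul_comm, ← hA p c hp, hEp p c hp]) |>.trans
      (one_div _).symm
  · exact ENNReal.eq_inv_of_mul_eq_one_left (by rw [mul_comm]; exact le_antisymm hI2 hI1) |>.trans
      (one_div _).symm
  · exact ENNReal.eq_inv_of_mul_eq_one_left (by rw [mul_comm]; exact le_antisymm hI4 hI3) |>.trans
      (one_div _).symm
  -- Averages over empty boxes would be 0; D⁻ ≥ 1 from (d) makes the boxes eventually nonempty.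
  · have hF1 := eventually_boxAverage_eq_one hF hFR hfa (zero_lt_one.trans_le hdl)
    have hFl := lowerMeasure_eq_one hF1
    have hFu := upperMeasure_eq_one hF1
    rw [hFl, mul_one] at hI1 hI2
    rw [hFu, mul_one] at hI3 hI4
    refine ⟨le_antisymm hI4 hI3, le_antisymm hI2 hI1, hFl, hFu, fun p c hp => ⟨?_, ?_⟩⟩
    · exact le_antisymm ((density_le_upperDensity a hp c).trans hI2)
        (hI3.trans (lowerDensity_le_density a hp c))
    · exact le_antisymm (hFu ▸ frameMeasure_le_upperMeasure a F hp c)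
        (hFl ▸ lowerMeasure_le_frameMeasure a F hp c)
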